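/- Let $(\mathcal X,\Sigma)$ be a standard Borel space, let $X=(X_t)_{t\in\mathcal T}$ be an $\mathcal X$-valued stochastic process on an index set $\mathcal T$, and let $d:\mathcal T\times\mathcal T\to[0,1]$ be a premetric, i.e. $d(t,t')=d(t',t)$ and $d(t,t)=0$ for all $t,t'\in\mathcal T$. Assume: (i) $(d,\mathcal T)$ is infinitely separable: there is a countable $\mathfrak T\subseteq\mathcal T$ such that for each $t\in\mathcal T$ there is a Cauchy sequence $(t_n)$ in $\mathfrak T$ that takes infinitely many distinct values and satisfies $d(t_n,t)\to0$; (ii) $X$ is locally exchangeable with respect to $d$: for each finite $T\subseteq\mathcal T$ and each injection $\pi:T\to\mathcal T$, the total variation distance $\sup_A|P(A)-Q(A)|$ between the laws $P$ of $(X_t)_{t\in T}$ and $Q$ of $(X_{\pi(t)})_{t\in T}$ is at most $\sum_{t\in T}d(t,\pi(t))$. Then there is a process $G=(G_t)_{t\in\mathcal T}$ of random probability measures on $\mathcal X$ such that, for all finite $T\subseteq\mathcal T$ and all $t,t'\in\mathcal T$, $$\Pr(X_T\in\cdot\mid G)=\prod_{t\in T}G_t\ \text{ a.s.},\qquad \sup_{A\in\Sigma}\mathbb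 E\,|G_t(A)-G_{t'}(A)|\le d(t,t'). \tag{1}$$ Moreover, let $G$ be any process of random probability measures satisfying (1). Let $T\subseteq\mathcal T$ be finite, and let $\xi_t:\mathcal T\to[0,1]$, $t\in T$, be weighting functions with $\sum_{t\in T}\xi_t(\tau)=1$ for every $\tau\in\mathcal T$. Let $\widehat G_\tau=\sum_{t\in T}\xi_t(\tau)\,\delta_{X_t}$ be the local empirical measure, let $h:\mathcal X\to[0,1]$ be measurable, and write $\mu(h)=\int h\,d\mu$. For a simple function $\hat h:\mathcal X\to[0,1]$ let $|\hat h|$ denote the sum of its distinct values, and put $$b_{h,t}(\tau)=\inf_{\hat h}\Big(|\hat h|\,d(t,\tau)+2\sup_{x\in\mathcal X}|h(x)-\hat h(x)|\Big),$$ where the infimum is over all simple functions $\hat h:\mathcal X\to[0,1]$. Then for every $\tau\in\mathcal T$, $$\mathbb E\big[(\widehat G_\tau(h)-G_\tau(h))^2\big]\le\frac14\sum_{t\in T}\xi_t(\tau)^2+\sum_{t\in T}\xi_t(\tau)\,b_{h,t}(\tau),$$ and for every $\delta>0$, $$\Pr\big(|\widehat G_\tau(h)-G_\tau(h)|>\delta\big)\le\inf_{\epsilon\in(0,\delta)}\left[2\exp\left(-\frac{2\epsilon^2}{\sum_{t\in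 T}\xi_t(\tau)^2}\right)+(\delta-\epsilon)^{-1}\sum_{t\in T}\xi_t(\tau)\,b_{h,t}(\tau)\right].$$ -/

import Mathlib

open MeasureTheory ProbabilityTheory Filter Topology

noncomputable section

namespace LocalExch

/-- A premetric on a set of covariates: a symmetric function with values in `[0, 1]` that
vanishes on the diagonal. -/
structure IsPremetric {C : Type*} (d : C → C → ℝ) : Prop where
  mem_Icc : ∀ s t, d s t ∈ Set.Icc (0 : ℝ) 1
  symm : ∀ s t, d s t = d t s
  self : ∀ t, d t t = 0

/-- Infinite separability: some countable set `S` of covariates is such that each covariate is the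
limit of a Cauchy sequence of elements of `S` that takes infinitely many distinct values. -/
def IsInfinitelySeparable {C : Type*} (d : C → C → ℝ) : Prop :=
  ∃ S : Set C, S.Countable ∧ ∀ t : C, ∃ u : ℕ → C,
    (∀ n, u n ∈ S) ∧
    (∀ ε > (0 : ℝ), ∃ N, ∀ m ≥ N, ∀ n ≥ N, d (u m) (u n) < ε) ∧
    Tendsto (fun n => d (u n) t) atTop (𝓝 0) ∧
    (Set.range u).Infinite

/-- The total variation distance `sup_A |P A - Q A|`, over the measurable sets `A`, between
two probability measures. -/
def tvDist {Y : Type*} [MeasurableSpace Y] (P Q : Measure Y) : ℝ :=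
  ⨆ A : {A : Set Y // MeasurableSet A}, |P.real A.1 - Q.real A.1|

/-- Local exchangeability of the process `X` with respect to `d`: for every finite set `T` of
covariates and every injection `π` of `T` into the covariates, the laws of `(X t)_{t ∈ T}` and
`(X (π t))_{t ∈ T}` are within `∑ t ∈ T, d t (π t)` in total variation. -/
def IsLocallyExchangeable {Ω C E : Type*} [MeasurableSpace Ω] [MeasurableSpace E]
    (d : C → C → ℝ) (X : C → Ω → E) (P : Measure Ω) : Prop :=
  ∀ (T : Finset C) (π : T → C), Function.Injective π →
    tvDist (P.map (fun ω (t : T) => X t ω)) (P.map (fun ω (t : T) => X (π t) ω))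
      ≤ ∑ t : T, d t (π t)

/-- The σ-algebra on `Ω` generated by a random measure-valued process `G = (G t)_t`. -/
abbrev sigmaOf {Ω C E : Type*} [MeasurableSpace Ω] [MeasurableSpace E]
    (G : C → Kernel Ω E) : MeasurableSpace Ω :=
  ⨆ t : C, MeasurableSpace.comap (fun ω => G t ω) inferInstance

/-- `G` is a directing process of the de Finetti representation of the locally exchangeable
process `X`: it is a family of random probability measures on the state space (a kernel `G t` is
a measurable map `ω ↦ G t ω` into the measures) such that, for each finite set `T` of covariates,
the conditional law of `(X t)_{t ∈ T}` given `G` is almost surely the product of the `G t`, and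
such that `sup_A 𝔼 |G s A - G t A| ≤ d s t` for all covariates `s`, `t`. -/
structure IsDirectingProcess {Ω C E : Type*} [MeasurableSpace Ω] [MeasurableSpace E]
    (d : C → C → ℝ) (X : C → Ω → E) (P : Measure Ω) (G : C → Kernel Ω E) : Prop where
  isMarkov : ∀ t, IsMarkovKernel (G t)
  condLaw : ∀ (T : Finset C) (A : Set (T → E)), MeasurableSet A →
    P[((fun ω (t : T) => X t ω) ⁻¹' A).indicator (fun _ => (1 : ℝ)) | sigmaOf G]
      =ᵐ[P] fun ω => (Measure.pi (fun t : T => G t ω)).real A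
  smooth : ∀ (s t : C) (A : Set E), MeasurableSet A →
    ∫ ω, |(G s ω).real A - (G t ω).real A| ∂P ≤ d s t

/-- Weighting functions `ξ t : C → [0, 1]`, for `t` in the finite set `T` of observed covariates,
that sum to one at every covariate. -/
structure IsWeighting {C : Type*} (T : Finset C) (ξ : C → C → ℝ) : Prop where
  mem_Icc : ∀ t ∈ T, ∀ τ, ξ t τ ∈ Set.Icc (0 : ℝ) 1
  sum_eq_one : ∀ τ, ∑ t ∈ T, ξ t τ = 1

/-- The local empirical measure `∑ t ∈ T, ξ t τ • δ_{X t}` at the covariate `τ`. -/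
def localEmpirical {Ω C E : Type*} [MeasurableSpace E]
    (X : C → Ω → E) (T : Finset C) (ξ : C → C → ℝ) (τ : C) (ω : Ω) : Measure E :=
  ∑ t ∈ T, ENNReal.ofReal (ξ t τ) • Measure.dirac (X t ω)

/-- The sum `|f|` of the levels of a simple function `f`, that is, of its distinct values. -/
def levelSum {E : Type*} [MeasurableSpace E] (f : SimpleFunc E ℝ) : ℝ :=
  ∑ y ∈ f.range, y

/-- The coefficient `b_{h,t}(τ)`: the infimum of `|f| d(t, τ) + 2 ‖h - f‖_∞` over the simple
functions `f` with values in `[0, 1]`. -/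
def approxCoeff {C E : Type*} [MeasurableSpace E]
    (d : C → C → ℝ) (h : E → ℝ) (t τ : C) : ℝ :=
  ⨅ f : {f : SimpleFunc E ℝ // ∀ x, f x ∈ Set.Icc (0 : ℝ) 1},
    (levelSum f.1 * d t τ + 2 * ⨆ x, |h x - f.1 x|)

end LocalExch

end

/-! The directing measure `G t` is the conditional law of `X t` given the tail σ-algebra of a
countable family of coordinates. Infinite separability supplies coordinates `X (v k)` that run off
to the tail while `d (v k) t → 0`. Local exchangeability then lets `X (v k)` replace `X t`
asymptotically on any event determined by coordinates other than `t`. So all other coordinates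
predict `X t` no better than the tail does (`IsLocallyExchangeable.condExp_coordSigma_compl_ae_eq`).
Replacing the factors of a product of indicators one at a time gives the conditional product law.
For the smoothness of `G`, the sign of `G s A - G t A` is a tail event, so `𝔼 |G s A - G t A|` is a
difference of the probabilities of one event read at `s` and at `t`; exchangeability bounds it by `d
s t`.

The estimates use only the defining properties of a directing process. Given `G`, the observations
are independent, so the local empirical mean fluctuates around `∑ t, ξ t τ * G t h` with variance at
most `1/4 * ∑ t, ξ t τ ^ 2` and with Hoeffding tails. The distance from this conditional mean to `G
τ h` is a bias, controlled in `L¹` by approximating `h` with simple functions and applying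
smoothness on each level set (`IsDirectingProcess.integral_abs_sub_le_approxCoeff`). -/

namespace LocalExch

open scoped symmDiff

/-! ### Events determined by sets of coordinates and their finite approximation -/

section Coordinates

variable {Ω C E : Type*} [mE : MeasurableSpace E]

/-- The σ-algebra generated by the coordinates `X r`, for `r` in `R`. -/
abbrev coordSigma (X : C → Ω → E) (R : Set C) : MeasurableSpace Ω :=
  ⨆ r ∈ R, MeasurableSpace.comap (X r) mE

lemma coordSigma_mono (X : C → Ω → E) {R R' : Set C} (h : R ⊆ R') :
    coordSigma X R ≤ coordSigma X R' :=
  biSup_mono h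

lemma coordSigma_le [mΩ : MeasurableSpace Ω] {X : C → Ω → E} (hX : ∀ t, Measurable (X t))
    (R : Set C) : coordSigma X R ≤ mΩ :=
  iSup₂_le fun r _ => (hX r).comap_le

lemma measurable_coordSigma (X : C → Ω → E) {R : Set C} {r : C} (hr : r ∈ R) :
    Measurable[coordSigma X R] (X r) :=
  measurable_iff_comap_le.2 (le_iSup₂_of_le r hr le_rfl)

lemma exists_eq_preimage_of_measurableSet_coordSigma (X : C → Ω → E) (F : Finset C) {B : Set Ω}
    (hB : MeasurableSet[coordSigma X (F : Set C)] B) :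
    ∃ D : Set (F → E), MeasurableSet D ∧ (fun ω (r : F) => X r ω) ⁻¹' D = B := by
  have h : coordSigma X (F : Set C)
      ≤ MeasurableSpace.comap (fun ω (r : F) => X r ω) MeasurableSpace.pi := by
    refine iSup₂_le fun r hr => ?_
    have : X r = (fun y : F → E => y ⟨r, hr⟩) ∘ (fun ω (r : F) => X r ω) := rfl
    rw [this, ← MeasurableSpace.comap_comp]
    exact MeasurableSpace.comap_mono (measurable_pi_apply _).comap_le
  exact h B hB

/-- Events depending on finitely many coordinates in `R` form a ring that generates `coordSigma X
R`, and a generating ring is dense in measure. This reduces infinite families to the finite ones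
that local exchangeability speaks of. -/
lemma exists_cylinder_symmDiff_lt [mΩ : MeasurableSpace Ω] {P : Measure Ω} [IsFiniteMeasure P]
    {X : C → Ω → E} (hX : ∀ t, Measurable (X t)) {R : Set C} {B : Set Ω} (hB : MeasurableSet[coordSigma X R] B)
    {ε : ℝ} (hε : 0 < ε) :
    ∃ F : Finset C, (F : Set C) ⊆ R ∧ ∃ B' : Set Ω,
      MeasurableSet[coordSigma X (F : Set C)] B' ∧ P.real (B' ∆ B) < ε := by
  classical
  let K : Set (Set Ω) :=
    {B | ∃ F : Finset C, (F : Set C) ⊆ R ∧ MeasurableSet[coordSigma X (F : Set C)] B}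
  have hunion : ∀ {F F' : Finset C}, (F : Set C) ⊆ R → (F' : Set C) ⊆ R →
      ((F ∪ F' : Finset C) : Set C) ⊆ R := by
    intro F F' h h'
    rw [Finset.coe_union]
    exact Set.union_subset h h'
  have hl : ∀ F F' : Finset C,
      coordSigma X (F : Set C) ≤ coordSigma X ((F ∪ F' : Finset C) : Set C) :=
    fun F F' => coordSigma_mono X (by rw [Finset.coe_union]; exact Set.subset_union_left)
  have hr : ∀ F F' : Finset C,
      coordSigma X (F' : Set C) ≤ coordSigma X ((F ∪ F' : Finset C) : Set C) :=
    fun F F' => coordSigma_mono X (by rw [Finset.coe_union]; exact Set.subset_union_right)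
  have hK : IsSetRing K := by
    refine ⟨⟨∅, by simp, @MeasurableSet.empty _ (coordSigma X _)⟩, ?_, ?_⟩
    · rintro s t ⟨F, hF, hs⟩ ⟨F', hF', ht⟩
      exact ⟨F ∪ F', hunion hF hF', @MeasurableSet.union _ _ _ _ (hl F F' s hs) (hr F F' t ht)⟩
    · rintro s t ⟨F, hF, hs⟩ ⟨F', hF', ht⟩
      exact ⟨F ∪ F', hunion hF hF', @MeasurableSet.diff _ _ _ _ (hl F F' s hs) (hr F F' t ht)⟩
  have hgen : coordSigma X R = MeasurableSpace.generateFrom K := by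
    apply le_antisymm
    · refine iSup₂_le fun r hrR s hs => MeasurableSpace.measurableSet_generateFrom ?_
      refine ⟨{r}, by simpa using hrR, ?_⟩
      obtain ⟨A, hA, rfl⟩ := hs
      exact measurable_coordSigma X (by simp) hA
    · refine MeasurableSpace.generateFrom_le ?_
      rintro s ⟨F, hF, hs⟩
      exact coordSigma_mono X hF s hs
  have hm := coordSigma_le hX R
  obtain ⟨B', ⟨F, hF, hB'⟩, hlt⟩ :=
    @exists_measure_symmDiff_lt_of_generateFrom_isSetRing Ω (coordSigma X R) (P.trim hm) _ K hK
      ⟨{Set.univ}, Set.countable_singleton _,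
        by simpa using ⟨∅, by simp, @MeasurableSet.univ _ (coordSigma X _)⟩, by simp⟩
      hgen B hB (ENNReal.ofReal ε) (by simpa using hε)
  refine ⟨F, hF, B', hB', ?_⟩
  rw [trim_measurableSet_eq hm (@MeasurableSet.symmDiff _ _ _ _ (coordSigma_mono X hF _ hB') hB)]
    at hlt
  exact ENNReal.toReal_lt_of_lt_ofReal hlt

end Coordinates

/-! ### Moving a single coordinate under local exchangeability -/

section TotalVariation

variable {Ω C E : Type*} [mΩ : MeasurableSpace Ω] [mE : MeasurableSpace E]

lemma abs_sub_le_tvDist {Y : Type*} [MeasurableSpace Y] (P Q : Measure Y) [IsProbabilityMeasure P]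
    [IsProbabilityMeasure Q] {A : Set Y} (hA : MeasurableSet A) :
    |P.real A - Q.real A| ≤ tvDist P Q := by
  refine le_ciSup (f := fun A : {A : Set Y // MeasurableSet A} => |P.real A.1 - Q.real A.1|)
    ⟨1, ?_⟩ ⟨A, hA⟩
  rintro _ ⟨B, rfl⟩
  have h1 := measureReal_le_one (μ := P) (s := B.1)
  have h2 := measureReal_le_one (μ := Q) (s := B.1)
  have h3 := measureReal_nonneg (μ := P) (s := B.1)
  have h4 := measureReal_nonneg (μ := Q) (s := B.1)
  exact abs_sub_le_iff.2 ⟨by linarith, by linarith⟩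

variable {P : Measure Ω} [IsProbabilityMeasure P] {d : C → C → ℝ} {X : C → Ω → E}

/-- The sets `{X s ∈ A} ∩ B ∪ {X s ∉ A} ∩ B'`, obtained from a set `A` of states by switching
between `A` and its complement according to events. -/
def switched (X : C → Ω → E) (A : Set E) (B B' : Set Ω) (s : C) : Set Ω :=
  (X s ⁻¹' A ∩ B) ∪ (X s ⁻¹' Aᶜ ∩ B')

/-- The injection on `insert s F` that sends `s` to `t` and fixes `F` carries one event to the
other; its cost is `d s t` because `d` vanishes on the diagonal. -/
lemma IsLocallyExchangeable.abs_measureReal_cylinder_sub_le (hexch : IsLocallyExchangeable d X P)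
    (hd : IsPremetric d) (hX : ∀ t, Measurable (X t)) {F : Finset C} {s t : C} (hs : s ∉ F)
    (ht : t ∉ F) {A : Set E} (hA : MeasurableSet A) {B B' : Set Ω}
    (hB : MeasurableSet[coordSigma X (F : Set C)] B)
    (hB' : MeasurableSet[coordSigma X (F : Set C)] B') :
    |P.real (switched X A B B' s) - P.real (switched X A B B' t)| ≤ d s t := by
  classical
  obtain ⟨D, hD, rfl⟩ := exists_eq_preimage_of_measurableSet_coordSigma X F hB
  obtain ⟨D', hD', rfl⟩ := exists_eq_preimage_of_measurableSet_coordSigma X F hB'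
  let T := insert s F
  let π : T → C := fun r => if (r : C) = s then t else r
  have hne : ∀ r ∈ F, r ≠ s := fun r hr h => hs (h ▸ hr)
  have hπ : Function.Injective π := by
    rintro ⟨a, ha⟩ ⟨b, hb⟩ hab
    simp only [T, Finset.mem_insert] at ha hb
    simp only [π] at hab
    apply Subtype.ext
    change a = b
    split_ifs at hab with h1 h2 h2
    · rw [h1, h2]
    · exact absurd (hab ▸ hb.resolve_left h2) ht
    · exact absurd (hab ▸ ha.resolve_left h1) ht
    · exact hab
  let s' : T := ⟨s, Finset.mem_insert_self _ _⟩
  let ρ : (T → E) → (F → E) := fun y r => y ⟨r, Finset.mem_insert_of_mem r.2⟩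
  have hρ : Measurable ρ := measurable_pi_lambda _ fun r => measurable_pi_apply _
  let A' : Set (T → E) :=
    ((fun y => y s') ⁻¹' A ∩ ρ ⁻¹' D) ∪ ((fun y => y s') ⁻¹' Aᶜ ∩ ρ ⁻¹' D')
  have hA' : MeasurableSet A' :=
    ((measurable_pi_apply s' hA).inter (hρ hD)).union
      ((measurable_pi_apply s' hA.compl).inter (hρ hD'))
  have m1 : Measurable (fun ω (r : T) => X r ω) := measurable_pi_lambda _ fun r => hX r
  have m2 : Measurable (fun ω (r : T) => X (π r) ω) := measurable_pi_lambda _ fun r => hX (π r)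
  have := Measure.isProbabilityMeasure_map (μ := P) m1.aemeasurable
  have := Measure.isProbabilityMeasure_map (μ := P) m2.aemeasurable
  have key := (abs_sub_le_tvDist _ _ hA').trans (hexch T π hπ)
  rw [map_measureReal_apply m1 hA', map_measureReal_apply m2 hA'] at key
  have e1 : (fun ω (r : T) => X r ω) ⁻¹' A'
      = switched X A ((fun ω (r : F) => X r ω) ⁻¹' D) ((fun ω (r : F) => X r ω) ⁻¹' D') s := rfl
  have e2 : (fun ω (r : T) => X (π r) ω) ⁻¹' A'
      = switched X A ((fun ω (r : F) => X r ω) ⁻¹' D) ((fun ω (r : F) => X r ω) ⁻¹' D') t := by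
    have h1 : ∀ ω, X (π s') ω = X t ω := fun ω => by simp [π, s']
    have h2 : ∀ ω, ρ (fun r : T => X (π r) ω) = fun r : F => X r ω := fun ω => by
      funext r
      simp [ρ, π, hne r r.2]
    ext ω
    simp only [A', switched, Set.mem_preimage, Set.mem_union, Set.mem_inter_iff, h2, h1]
  have e3 : ∑ r : T, d r (π r) = d s t := by
    rw [Finset.sum_eq_single s']
    · simp [π, s']
    · intro r _ hr
      have : (r : C) ≠ s := fun h => hr (Subtype.ext h)
      simp [π, this, hd.self]
    · simp
  rwa [e1, e2, e3] at key

lemma IsLocallyExchangeable.abs_measureReal_switched_sub_le (hexch : IsLocallyExchangeable d X P)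
    (hd : IsPremetric d) (hX : ∀ t, Measurable (X t)) {s t : C}
    {A : Set E} (hA : MeasurableSet A) {B : Set Ω}
    (hB : MeasurableSet[coordSigma X {s, t}ᶜ] B) :
    |P.real (switched X A B Bᶜ s) - P.real (switched X A B Bᶜ t)| ≤ d s t := by
  refine le_of_forall_pos_le_add fun ε hε => ?_
  obtain ⟨F, hF, B', hB', hlt⟩ := exists_cylinder_symmDiff_lt (P := P) hX hB (half_pos hε)
  have hs : s ∉ F := fun h => by simpa using hF h
  have ht : t ∉ F := fun h => by simpa using hF h
  have key := hexch.abs_measureReal_cylinder_sub_le hd hX hs ht hA hB'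
    (@MeasurableSet.compl _ _ _ hB')
  have mB := coordSigma_le hX _ _ hB
  have mB' := coordSigma_le hX _ _ hB'
  -- Outside `B' ∆ B` both switched sets apply the same test to `X r`, so the approximation error
  -- does not depend on `r`.
  have hsw : ∀ r, switched X A B' B'ᶜ r ∆ switched X A B Bᶜ r ⊆ B' ∆ B := by
    intro r ω
    simp only [switched, Set.mem_symmDiff, Set.mem_union, Set.mem_inter_iff, Set.mem_preimage,
      Set.mem_compl_iff]
    tauto
  have hm : ∀ (D : Set Ω), MeasurableSet D → ∀ r, MeasurableSet (switched X A D Dᶜ r) :=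
    fun D hD r => ((hX r hA).inter hD).union ((hX r hA.compl).inter hD.compl)
  have happ : ∀ r, |P.real (switched X A B' B'ᶜ r) - P.real (switched X A B Bᶜ r)| ≤ ε / 2 :=
    fun r => (abs_measureReal_sub_le_measureReal_symmDiff (hm _ mB' r).nullMeasurableSet
      (hm _ mB r).nullMeasurableSet).trans ((measureReal_mono (hsw r)).trans hlt.le)
  have h1 := abs_le.1 (happ s)
  have h2 := abs_le.1 (happ t)
  have h3 := abs_le.1 key
  exact abs_le.2 ⟨by linarith, by linarith⟩

end TotalVariation

/-! ### Conditional expectations identified through weak limits -/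

section Convergence

variable {Ω : Type*} {m' m : MeasurableSpace Ω} [mΩ : MeasurableSpace Ω] {P : Measure Ω}
  [IsFiniteMeasure P] {g : Ω → ℝ} {u : ℕ → Ω → ℝ}

/-- By linearity, convergence on sets extends to simple test functions; these are dense in `L¹`, and
the uniform bound on `u k` and `g` controls the error. -/
lemma tendsto_integral_mul_of_tendsto_setIntegral (hm : m ≤ mΩ)
    (hg : AEStronglyMeasurable g P) (hg1 : ∀ ω, ‖g ω‖ ≤ 1)
    (hu : ∀ k, AEStronglyMeasurable (u k) P) (hu1 : ∀ k ω, ‖u k ω‖ ≤ 1)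
    (hlim : ∀ B, MeasurableSet[m] B →
      Tendsto (fun k => ∫ ω in B, u k ω ∂P) atTop (𝓝 (∫ ω in B, g ω ∂P)))
    {V : Ω → ℝ} (hVm : StronglyMeasurable[m] V) (hV : Integrable V P) :
    Tendsto (fun k => ∫ ω, u k ω * V ω ∂P) atTop (𝓝 (∫ ω, g ω * V ω ∂P)) := by
  have hint : ∀ {W w : Ω → ℝ}, Integrable W P → AEStronglyMeasurable w P → (∀ ω, ‖w ω‖ ≤ 1) →
      Integrable (fun ω => w ω * W ω) P := fun hW hw hw1 =>
    hW.bdd_mul hw (Eventually.of_forall hw1)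
  have hsimple : ∀ φ : @SimpleFunc Ω m ℝ, Integrable φ P ∧
      Tendsto (fun k => ∫ ω, u k ω * φ ω ∂P) atTop (𝓝 (∫ ω, g ω * φ ω ∂P)) := by
    intro φ
    induction φ using SimpleFunc.induction with
    | const c hs =>
      rename_i s
      have hs' := hm _ hs
      have key : ∀ w : Ω → ℝ, ∫ ω, w ω * s.indicator (fun _ => c) ω ∂P
          = (∫ ω in s, w ω ∂P) * c := by
        intro w
        rw [← integral_mul_const, ← integral_indicator hs']
        congr 1 with ω
        by_cases h : ω ∈ s <;> simp [h]
      have hφ : (⇑(@SimpleFunc.piecewise Ω ℝ m s hs (@SimpleFunc.const Ω ℝ m c)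
          (@SimpleFunc.const Ω ℝ m 0)))
          = s.indicator (fun _ => c) := by
        ext ω
        by_cases h : ω ∈ s <;> simp [h]
      rw [hφ]
      refine ⟨(integrable_const c).indicator hs', ?_⟩
      simp_rw [key]
      exact (hlim s hs).mul_const c
    | add _ hf hf' =>
      obtain ⟨i1, t1⟩ := hf
      obtain ⟨i2, t2⟩ := hf'
      refine ⟨i1.add i2, ?_⟩
      simp only [SimpleFunc.coe_add, Pi.add_apply, mul_add]
      rw [integral_add (hint i1 hg hg1) (hint i2 hg hg1)]
      simp_rw [fun k => integral_add (hint i1 (hu k) (hu1 k)) (hint i2 (hu k) (hu1 k))]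
      exact t1.add t2
  rw [Metric.tendsto_atTop]
  intro ε hε
  obtain ⟨φ, hφ⟩ : ∃ φ : @SimpleFunc Ω m ℝ, ∫ ω, ‖V ω - φ ω‖ ∂P < ε / 3 := by
    have hV' : MemLp V 1 (P.trim hm) := memLp_one_iff_integrable.2 (hV.trim hm hVm)
    obtain ⟨φ, hφ, -⟩ := @MemLp.exists_simpleFunc_eLpNorm_sub_lt Ω m 1 ℝ _ V (P.trim hm) hV'
      ENNReal.one_ne_top
      (ENNReal.ofReal (ε / 3)) (by simp; linarith)
    refine ⟨φ, ?_⟩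
    rw [eLpNorm_trim hm (hVm.sub φ.stronglyMeasurable), eLpNorm_one_eq_lintegral_enorm] at hφ
    change ∫ ω, ‖(V - ⇑φ) ω‖ ∂P < ε / 3
    rw [integral_norm_eq_lintegral_enorm (hV.sub (hsimple φ).1).aestronglyMeasurable]
    exact ENNReal.toReal_lt_of_lt_ofReal hφ
  obtain ⟨hφi, hφt⟩ := hsimple φ
  have hclose : ∀ w : Ω → ℝ, AEStronglyMeasurable w P → (∀ ω, ‖w ω‖ ≤ 1) →
      |∫ ω, w ω * V ω ∂P - ∫ ω, w ω * φ ω ∂P| < ε / 3 := by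
    intro w hw hw1
    rw [← integral_sub (hint hV hw hw1) (hint hφi hw hw1), ← Real.norm_eq_abs]
    refine (norm_integral_le_integral_norm _).trans_lt (lt_of_le_of_lt ?_ hφ)
    refine integral_mono ((hint hV hw hw1).sub (hint hφi hw hw1)).norm (hV.sub hφi).norm ?_
    intro ω
    change ‖w ω * V ω - w ω * φ ω‖ ≤ ‖V ω - φ ω‖
    rw [← mul_sub, norm_mul]
    exact mul_le_of_le_one_left (norm_nonneg _) (hw1 ω)
  obtain ⟨N, hN⟩ := Metric.tendsto_atTop.1 hφt (ε / 3) (by linarith)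
  refine ⟨N, fun k hk => ?_⟩
  have h1 := abs_lt.1 (hclose (u k) (hu k) (hu1 k))
  have h2 := abs_lt.1 (hclose g hg hg1)
  have h3 := abs_lt.1 (hN k hk)
  exact abs_lt.2 ⟨by linarith, by linarith⟩

lemma integral_mul_eq_integral_condExp_mul (hm : m ≤ mΩ) (hg : Integrable g P) {V : Ω → ℝ}
    (hVm : StronglyMeasurable[m] V) (hgV : Integrable (fun ω => g ω * V ω) P) :
    ∫ ω, g ω * V ω ∂P = ∫ ω, (P[g|m]) ω * V ω ∂P := by
  rw [← integral_condExp hm]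
  exact integral_congr_ae (condExp_mul_of_stronglyMeasurable_right hVm hgV hg)

/-- An orthogonality argument. The difference `V` of the two conditional expectations is orthogonal
to bounded `m'`-measurable functions, hence to `u k` for large `k`, hence in the limit to `g`. It is
then orthogonal to both conditional expectations, so `∫ V² = 0`. -/
lemma condExp_ae_eq_of_tendsto_setIntegral (hm' : m' ≤ m) (hm : m ≤ mΩ)
    (hg : AEStronglyMeasurable g P) (hg1 : ∀ ω, ‖g ω‖ ≤ 1)
    (hu : ∀ k, AEStronglyMeasurable (u k) P) (hu1 : ∀ k ω, ‖u k ω‖ ≤ 1)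
    (hum : ∀ᶠ k in atTop, StronglyMeasurable[m'] (u k))
    (hlim : ∀ B, MeasurableSet[m] B →
      Tendsto (fun k => ∫ ω in B, u k ω ∂P) atTop (𝓝 (∫ ω in B, g ω ∂P))) :
    P[g|m] =ᵐ[P] P[g|m'] := by
  have hgi : Integrable g P := Integrable.of_bound hg 1 (Eventually.of_forall hg1)
  set V : Ω → ℝ := P[g|m] - P[g|m'] with hV
  have hVm : StronglyMeasurable[m] V :=
    stronglyMeasurable_condExp.sub (stronglyMeasurable_condExp.mono hm')
  have hVi : Integrable V P := integrable_condExp.sub integrable_condExp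
  have hint : ∀ w : Ω → ℝ, AEStronglyMeasurable w P → (∀ᵐ ω ∂P, ‖w ω‖ ≤ 1) →
      Integrable (fun ω => V ω * w ω) P := fun w hw hw1 => hVi.mul_bdd hw hw1
  have hV0 : P[V|m'] =ᵐ[P] 0 := by
    have h1 := condExp_sub (μ := P) (f := P[g|m]) (g := P[g|m']) integrable_condExp
      integrable_condExp m'
    have h2 := condExp_condExp_of_le (μ := P) (f := g) hm' hm
    have h3 := condExp_of_stronglyMeasurable (μ := P) (hm'.trans hm)
      (stronglyMeasurable_condExp (f := g) (m := m')) integrable_condExp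
    filter_upwards [h1, h2] with ω e1 e2
    rw [e1, Pi.sub_apply, e2, h3]
    simp
  have hzero : ∀ w : Ω → ℝ, StronglyMeasurable[m'] w → (∀ᵐ ω ∂P, ‖w ω‖ ≤ 1) →
      ∫ ω, V ω * w ω ∂P = 0 := by
    intro w hw hw1
    rw [integral_mul_eq_integral_condExp_mul (hm'.trans hm) hVi hw
      (hint w (hw.mono (hm'.trans hm)).aestronglyMeasurable hw1)]
    rw [integral_congr_ae (g := 0)]
    · simp
    · filter_upwards [hV0] with ω h
      simp [h]
  have hgV : ∫ ω, g ω * V ω ∂P = 0 := by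
    refine tendsto_nhds_unique
      (tendsto_integral_mul_of_tendsto_setIntegral hm hg hg1 hu hu1 hlim hVm hVi) ?_
    refine (tendsto_const_nhds (x := (0 : ℝ))).congr' ?_
    filter_upwards [hum] with k hk
    rw [← hzero (u k) hk (Eventually.of_forall (hu1 k))]
    simp_rw [mul_comm]
  have hbd : ∀ m'' : MeasurableSpace Ω, ∀ᵐ ω ∂P, ‖(P[g|m'']) ω‖ ≤ 1 := fun m'' => by
    simpa using ae_bdd_abs_condExp_of_ae_bdd_abs (m := m'') (μ := P) (f := g) (R := 1)
      (Eventually.of_forall hg1)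
  have hMV : ∫ ω, V ω * (P[g|m]) ω ∂P = 0 := by
    rw [← hgV, integral_mul_eq_integral_condExp_mul hm hgi hVm (by
      simpa only [mul_comm] using hint g hg (Eventually.of_forall hg1))]
    simp_rw [mul_comm]
  have hNV : ∫ ω, V ω * (P[g|m']) ω ∂P = 0 := hzero _ stronglyMeasurable_condExp (hbd m')
  have i1 := hint _ (stronglyMeasurable_condExp.mono hm).aestronglyMeasurable (hbd m)
  have i2 := hint _ (stronglyMeasurable_condExp.mono (hm'.trans hm)).aestronglyMeasurable (hbd m')
  have hVV : ∫ ω, V ω * V ω ∂P = 0 := by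
    have : (fun ω => V ω * V ω) = fun ω => V ω * (P[g|m]) ω - V ω * (P[g|m']) ω := by
      ext ω
      rw [hV, Pi.sub_apply]
      ring
    rw [this, integral_sub i1 i2, hMV, hNV, sub_zero]
  have hVVi : Integrable (fun ω => V ω * V ω) P := by
    refine (i1.sub i2).congr (Eventually.of_forall fun ω => ?_)
    simp only [hV, Pi.sub_apply]
    ring
  have := (integral_eq_zero_iff_of_nonneg (fun ω => mul_self_nonneg (V ω)) hVVi).1 hVV
  filter_upwards [this] with ω h
  exact sub_eq_zero.1 (mul_self_eq_zero.1 h)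

/-- All the conditional expectations agree almost surely, so no reverse martingale theorem is
needed: their pointwise limsup is a version that is measurable for the intersection. -/
lemma condExp_iInf_ae_eq {n : ℕ → MeasurableSpace Ω} (hn : Antitone n) (hnm : ∀ k, n k ≤ m)
    (hm : m ≤ mΩ) (h : ∀ k, P[g|m] =ᵐ[P] P[g|n k]) :
    P[g|m] =ᵐ[P] P[g|⨅ k, n k] := by
  have hle : ⨅ k, n k ≤ m := (iInf_le _ 0).trans (hnm 0)
  set L : Ω → ℝ := fun ω => limsup (fun k => (P[g|n k]) ω) atTop with hL
  have hLM : P[g|m] =ᵐ[P] L := by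
    filter_upwards [ae_all_iff.2 h] with ω hω
    simp only [hL, ← hω]
    exact (limsup_const _).symm
  have hLm : Measurable[⨅ k, n k] L := by
    intro s hs
    rw [MeasurableSpace.measurableSet_iInf]
    intro j
    -- A limsup ignores its first `j` terms, and by antitonicity all the remaining ones are `n
    -- j`-measurable.
    have : L = fun ω => limsup (fun k => (P[g|n (k + j)]) ω) atTop := by
      ext ω
      exact (limsup_nat_add (fun k => (P[g|n k]) ω) j).symm
    rw [this]
    exact Measurable.limsup (fun k =>
      (stronglyMeasurable_condExp.measurable.mono (hn (Nat.le_add_left j k)) le_rfl)) hs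
  have hLi : Integrable L P := integrable_condExp.congr hLM
  have h2 := condExp_condExp_of_le (μ := P) (f := g) hle hm
  have h3 := condExp_congr_ae (m := ⨅ k, n k) hLM
  rw [condExp_of_stronglyMeasurable (hle.trans hm) hLm.stronglyMeasurable hLi] at h3
  exact hLM.trans (h3.symm.trans h2)

end Convergence

/-! ### The tail σ-algebra and sequences escaping into it -/

section Tail

variable {Ω C E : Type*} [mE : MeasurableSpace E]

/-- The tail σ-algebra of the coordinates `X r` for `r` in `S`, with `S` ordered by the
numbering `f`. -/
abbrev tailSigma (X : C → Ω → E) (S : Set C) (f : C → ℕ) : MeasurableSpace Ω :=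
  ⨅ n : ℕ, coordSigma X {r | r ∈ S ∧ n ≤ f r}

/-- Starting the tail after index `T.sup f` discards every element of `T`. -/
lemma tailSigma_le_coordSigma_compl (X : C → Ω → E) (S : Set C) (f : C → ℕ) (T : Finset C) :
    tailSigma X S f ≤ coordSigma X (T : Set C)ᶜ := by
  refine (iInf_le _ (T.sup f + 1)).trans (coordSigma_mono X ?_)
  rintro r ⟨-, hr⟩ hrT
  have := Finset.le_sup (f := f) hrT
  omega

lemma tailSigma_le [mΩ : MeasurableSpace Ω] {X : C → Ω → E} (hX : ∀ t, Measurable (X t))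
    (S : Set C) (f : C → ℕ) : tailSigma X S f ≤ mΩ :=
  (iInf_le _ 0).trans (coordSigma_le hX _)

lemma exists_seq_tendsto_of_infinite_range {d : C → C → ℝ} {S : Set C} {f : C → ℕ}
    (hf : Set.InjOn f S) {t : C} {u : ℕ → C} (huS : ∀ n, u n ∈ S)
    (hu : Tendsto (fun n => d (u n) t) atTop (𝓝 0)) (hinf : (Set.range u).Infinite) :
    ∃ v : ℕ → C, (∀ k, v k ∈ S) ∧ (∀ k, v k ≠ t) ∧ (∀ k, k ≤ f (v k)) ∧
      Tendsto (fun k => d (v k) t) atTop (𝓝 0) := by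
  have hex : ∀ k : ℕ, ∃ n ≥ k, u n ≠ t ∧ k ≤ f (u n) := by
    intro k
    by_contra! hcon
    apply hinf
    -- Injectivity of the numbering leaves only finitely many elements of `S` below `k`, so without
    -- a suitable `n` the range of `u` would be finite.
    have hfin : (S ∩ f ⁻¹' Set.Iio k).Finite :=
      Set.Finite.of_finite_image ((Set.finite_Iio k).subset (by rintro _ ⟨r, hr, rfl⟩; exact hr.2))
        (hf.mono Set.inter_subset_left)
    refine (((Set.finite_Iio k).image u).union (hfin.union (Set.finite_singleton t))).subset ?_
    rintro _ ⟨n, rfl⟩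
    rcases lt_or_ge n k with h | h
    · exact Or.inl ⟨n, h, rfl⟩
    · by_cases hut : u n = t
      · exact Or.inr (Or.inr hut)
      · exact Or.inr (Or.inl ⟨huS n, hcon n h hut⟩)
  choose n hn hnt hnf using hex
  exact ⟨fun k => u (n k), fun k => huS _, hnt, hnf,
    hu.comp (tendsto_atTop_mono hn tendsto_id)⟩

end Tail

/-! ### One coordinate given all the others -/

section ConditionalLaw

variable {Ω C E : Type*} [mΩ : MeasurableSpace Ω] [mE : MeasurableSpace E]
  {P : Measure Ω} [IsProbabilityMeasure P] {d : C → C → ℝ} {X : C → Ω → E}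

lemma IsLocallyExchangeable.abs_measureReal_preimage_inter_sub_le
    (hexch : IsLocallyExchangeable d X P)
    (hd : IsPremetric d) (hX : ∀ t, Measurable (X t)) {F : Finset C} {s t : C} (hs : s ∉ F)
    (ht : t ∉ F) {A : Set E} (hA : MeasurableSet A) {B : Set Ω}
    (hB : MeasurableSet[coordSigma X (F : Set C)] B) :
    |P.real (X s ⁻¹' A ∩ B) - P.real (X t ⁻¹' A ∩ B)| ≤ d s t := by
  simpa [switched] using hexch.abs_measureReal_cylinder_sub_le hd hX hs ht hA hB
    (@MeasurableSet.empty _ (coordSigma X (F : Set C)))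

/-- Replace `B` by an event on a finite set `F` that omits `t`. Once `v k` has left `F`, exchanging
`v k` for `t` costs at most `d (v k) t`. -/
lemma IsLocallyExchangeable.tendsto_measureReal_preimage_inter
    (hexch : IsLocallyExchangeable d X P)
    (hd : IsPremetric d) (hX : ∀ t, Measurable (X t)) {t : C} {v : ℕ → C}
    (hv : ∀ F : Finset C, ∀ᶠ k in atTop, v k ∉ F)
    (hvt : Tendsto (fun k => d (v k) t) atTop (𝓝 0)) {A : Set E} (hA : MeasurableSet A)
    {B : Set Ω} (hB : MeasurableSet[coordSigma X {t}ᶜ] B) :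
    Tendsto (fun k => P.real (X (v k) ⁻¹' A ∩ B)) atTop (𝓝 (P.real (X t ⁻¹' A ∩ B))) := by
  rw [Metric.tendsto_nhds]
  intro ε hε
  obtain ⟨F, hF, B', hB', hlt⟩ :=
    exists_cylinder_symmDiff_lt (P := P) hX hB (show 0 < ε / 3 by linarith)
  have ht : t ∉ F := fun h => by simpa using hF h
  have mB := coordSigma_le hX _ _ hB
  have mB' := coordSigma_le hX _ _ hB'
  have happ : ∀ r, |P.real (X r ⁻¹' A ∩ B') - P.real (X r ⁻¹' A ∩ B)| ≤ ε / 3 := by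
    intro r
    refine (abs_measureReal_sub_le_measureReal_symmDiff ((hX r hA).inter mB').nullMeasurableSet
      ((hX r hA).inter mB).nullMeasurableSet).trans ((measureReal_mono ?_).trans hlt.le)
    intro ω
    simp only [Set.mem_symmDiff, Set.mem_inter_iff]
    tauto
  filter_upwards [hv F, hvt.eventually (gt_mem_nhds (show 0 < ε / 3 by linarith))] with k hk hdk
  have h1 := abs_le.1 (happ (v k))
  have h2 := abs_le.1 (happ t)
  have h3 := abs_le.1 (hexch.abs_measureReal_preimage_inter_sub_le hd hX hk ht hA hB')
  exact abs_lt.2 ⟨by linarith, by linarith⟩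

/-- The conditional law of one coordinate given all the others is its conditional law given the
tail σ-algebra. -/
lemma IsLocallyExchangeable.condExp_coordSigma_compl_ae_eq
    (hexch : IsLocallyExchangeable d X P) (hd : IsPremetric d) (hX : ∀ t, Measurable (X t))
    {S : Set C} {f : C → ℕ} (hf : Set.InjOn f S) {t : C}
    (hsep : ∃ u : ℕ → C, (∀ n, u n ∈ S) ∧ Tendsto (fun n => d (u n) t) atTop (𝓝 0) ∧
      (Set.range u).Infinite) {A : Set E} (hA : MeasurableSet A) :
    P[(X t ⁻¹' A).indicator (fun _ => (1 : ℝ))|coordSigma X {t}ᶜ]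
      =ᵐ[P] P[(X t ⁻¹' A).indicator (fun _ => (1 : ℝ))|tailSigma X S f] := by
  obtain ⟨u, huS, hut, hui⟩ := hsep
  obtain ⟨v, hvS, hvt, hvf, hvd⟩ := exists_seq_tendsto_of_infinite_range hf huS hut hui
  have hvF : ∀ F : Finset C, ∀ᶠ k in atTop, v k ∉ F := by
    intro F
    filter_upwards [eventually_gt_atTop (F.sup f)] with k hk hkF
    have := Finset.le_sup (f := f) hkF
    have := hvf k
    omega
  have hvtail : ∀ n : ℕ, ∀ k ≥ n, v k ∈ {r | (r ∈ S ∧ n ≤ f r) ∧ r ≠ t} :=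
    fun n k hk => ⟨⟨hvS k, hk.trans (hvf k)⟩, hvt k⟩
  have hind : ∀ (Y : Set Ω) (ω : Ω), ‖Y.indicator (fun _ => (1 : ℝ)) ω‖ ≤ 1 := fun Y ω => by
    by_cases h : ω ∈ Y <;> simp [h]
  -- The approximating indicators are eventually measurable for coordinates of index at least `n`.
  -- Excluding `t` keeps this σ-algebra inside `coordSigma X {t}ᶜ`.
  have hstep : ∀ n : ℕ, P[(X t ⁻¹' A).indicator (fun _ => (1 : ℝ))|coordSigma X {t}ᶜ]
      =ᵐ[P] P[(X t ⁻¹' A).indicator (fun _ => (1 : ℝ))|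
          coordSigma X {r | (r ∈ S ∧ n ≤ f r) ∧ r ≠ t}] := by
    intro n
    refine condExp_ae_eq_of_tendsto_setIntegral
      (u := fun k => (X (v k) ⁻¹' A).indicator (fun _ => (1 : ℝ)))
      (coordSigma_mono X fun r hr => hr.2) (coordSigma_le hX _)
      (stronglyMeasurable_const.indicator (hX t hA)).aestronglyMeasurable (hind _)
      (fun k => (stronglyMeasurable_const.indicator (hX (v k) hA)).aestronglyMeasurable)
      (fun k => hind _) ?_ ?_
    · filter_upwards [eventually_ge_atTop n] with k hk
      exact stronglyMeasurable_const.indicator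
        (measurable_coordSigma X (hvtail n k hk) hA)
    · intro B hB
      have hI : ∀ r, ∫ ω in B, (X r ⁻¹' A).indicator (fun _ => (1 : ℝ)) ω ∂P
          = P.real (X r ⁻¹' A ∩ B) := by
        intro r
        rw [integral_indicator_const _ (hX r hA), smul_eq_mul, mul_one,
          measureReal_restrict_apply (hX r hA)]
      simp_rw [hI]
      exact hexch.tendsto_measureReal_preimage_inter hd hX hvF hvd hA hB
  have htail : ⨅ n : ℕ, coordSigma X {r | (r ∈ S ∧ n ≤ f r) ∧ r ≠ t} = tailSigma X S f := by
    apply le_antisymm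
    · exact iInf_mono fun n => coordSigma_mono X fun r hr => hr.1
    -- Beyond index `f t` the coordinate `t` is absent anyway, so excluding it does not change the
    -- tail.
    · refine le_iInf fun n => (iInf_le _ (max n (f t + 1))).trans (coordSigma_mono X ?_)
      rintro r ⟨hr, hr'⟩
      refine ⟨⟨hr, (le_max_left _ _).trans hr'⟩, ?_⟩
      rintro rfl
      have := (le_max_right _ _).trans hr'
      omega
  rw [← htail]
  refine condExp_iInf_ae_eq ?_ (fun n => coordSigma_mono X fun r hr => hr.2)
    (coordSigma_le hX _) hstep
  intro n n' h
  exact coordSigma_mono X fun r hr => ⟨⟨hr.1.1, h.trans hr.1.2⟩, hr.2⟩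

end ConditionalLaw

/-! ### Regular conditional laws and measurability of products -/

section Kernels

lemma exists_kernel_ae_eq_condExp {Ω E : Type*} {m : MeasurableSpace Ω} [mΩ : MeasurableSpace Ω]
    [MeasurableSpace E] [StandardBorelSpace E] [Nonempty E] {P : Measure Ω} [IsFiniteMeasure P]
    (hm : m ≤ mΩ) {Y : Ω → E} (hY : Measurable Y) :
    ∃ G : Kernel Ω E, IsMarkovKernel G ∧ Measurable[m] (fun ω => G ω) ∧
      ∀ A, MeasurableSet A →
        (fun ω => (G ω).real A) =ᵐ[P] P[(Y ⁻¹' A).indicator (fun _ => (1 : ℝ))|m] := by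
  let K : @Kernel Ω E m _ := @condDistrib Ω Ω E _ _ _ mΩ m Y id P _
  have hK : @IsMarkovKernel Ω E m _ K := by
    dsimp only [K]
    infer_instance
  have hKm : Measurable[m] (fun ω => K ω) := K.measurable
  refine ⟨⟨fun ω => K ω, hKm.mono hm le_rfl⟩, ⟨fun ω => hK.isProbabilityMeasure ω⟩, hKm,
    fun A hA => ?_⟩
  have h := @condDistrib_ae_eq_condExp Ω Ω E _ _ _ mΩ P _ id Y m A
    (measurable_iff_comap_le.2 (by rw [MeasurableSpace.comap_id]; exact hm)) hY hA
  rwa [MeasurableSpace.comap_id] at h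

variable {Ω E ι : Type*} [Fintype ι] [MeasurableSpace Ω] [MeasurableSpace E]

lemma measurable_measure_pi {μ : ι → Ω → Measure E} [∀ i ω, IsProbabilityMeasure (μ i ω)]
    (hμ : ∀ i, Measurable (μ i)) : Measurable fun ω => Measure.pi fun i => μ i ω := by
  refine Measurable.measure_of_isPiSystem_of_isProbabilityMeasure generateFrom_pi.symm
    isPiSystem_pi ?_
  rintro _ ⟨A, hA, rfl⟩
  simp_rw [Measure.pi_pi]
  exact Finset.measurable_prod _ fun i _ => Measure.measurable_coe (hA i trivial) |>.comp (hμ i)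

end Kernels

/-! ### From one coordinate to finite products -/

section Product

variable {Ω C E : Type*} {𝒯 : MeasurableSpace Ω} [mΩ : MeasurableSpace Ω]
  [mE : MeasurableSpace E] {P : Measure Ω} [IsFiniteMeasure P] {X : C → Ω → E}

lemma norm_prod_le_one {T : Finset C} {w : C → ℝ} (h : ∀ t, ‖w t‖ ≤ 1) : ‖∏ t ∈ T, w t‖ ≤ 1 := by
  rw [norm_prod]
  exact Finset.prod_le_one (fun _ _ => norm_nonneg _) fun t _ => h t

/-- Induction on `T`: the remaining factors and `W` do not involve coordinate `a`, so `g a` can be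
replaced by `G a`. Being `𝒯`-measurable, `G a` is then absorbed into `W`, which is why `W` is
general. -/
lemma integral_prod_mul_eq_of_condExp_coordSigma_compl (hX : ∀ t, Measurable (X t))
    (h𝒯 : ∀ T : Finset C, 𝒯 ≤ coordSigma X (T : Set C)ᶜ)
    {g G : C → Ω → ℝ} (hg : ∀ t, StronglyMeasurable[coordSigma X {t}] (g t))
    (hg1 : ∀ t ω, ‖g t ω‖ ≤ 1) (hG : ∀ t, StronglyMeasurable[𝒯] (G t)) (hG1 : ∀ t ω, ‖G t ω‖ ≤ 1)
    (hgG : ∀ t, P[g t|coordSigma X {t}ᶜ] =ᵐ[P] G t) (T : Finset C) {W : Ω → ℝ}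
    (hW : StronglyMeasurable[coordSigma X (T : Set C)ᶜ] W) (hW1 : ∀ ω, ‖W ω‖ ≤ 1) :
    ∫ ω, (∏ t ∈ T, g t ω) * W ω ∂P = ∫ ω, (∏ t ∈ T, G t ω) * W ω ∂P := by
  classical
  induction T using Finset.induction_on generalizing W with
  | empty => simp
  | insert a T ha ih =>
    have hgm : ∀ t, AEStronglyMeasurable (g t) P := fun t =>
      ((hg t).mono (coordSigma_le hX _)).aestronglyMeasurable
    have hprod : StronglyMeasurable[coordSigma X {a}ᶜ] (fun ω => ∏ t ∈ T, g t ω) := by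
      refine Finset.stronglyMeasurable_fun_prod _ fun t ht => (hg t).mono (coordSigma_mono X ?_)
      rintro r rfl rfl
      exact ha ht
    have hV : StronglyMeasurable[coordSigma X {a}ᶜ] (fun ω => (∏ t ∈ T, g t ω) * W ω) :=
      hprod.mul (hW.mono (coordSigma_mono X (Set.compl_subset_compl.2 (by simp))))
    have hga : Integrable (g a) P := Integrable.of_bound (hgm a) 1 (Eventually.of_forall (hg1 a))
    have hVb : ∀ ω, ‖(∏ t ∈ T, g t ω) * W ω‖ ≤ 1 := fun ω => by
      rw [norm_mul]
      exact mul_le_one₀ (norm_prod_le_one fun t => hg1 t ω) (norm_nonneg _) (hW1 ω)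
    have h1 := integral_mul_eq_integral_condExp_mul (coordSigma_le hX _) hga hV
      (hga.mul_bdd (hV.mono (coordSigma_le hX _)).aestronglyMeasurable (Eventually.of_forall hVb))
    have h2 : ∫ ω, (P[g a|coordSigma X {a}ᶜ]) ω * ((∏ t ∈ T, g t ω) * W ω) ∂P
        = ∫ ω, (∏ t ∈ T, g t ω) * (G a ω * W ω) ∂P := by
      refine integral_congr_ae ?_
      filter_upwards [hgG a] with ω hω
      rw [hω]
      ring
    have hGW : StronglyMeasurable[coordSigma X (T : Set C)ᶜ] (fun ω => G a ω * W ω) :=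
      ((hG a).mono (h𝒯 T)).mul
        (hW.mono (coordSigma_mono X (Set.compl_subset_compl.2 (by simp))))
    have hGW1 : ∀ ω, ‖G a ω * W ω‖ ≤ 1 := fun ω => by
      rw [norm_mul]
      exact mul_le_one₀ (hG1 a ω) (norm_nonneg _) (hW1 ω)
    calc ∫ ω, (∏ t ∈ insert a T, g t ω) * W ω ∂P
        = ∫ ω, g a ω * ((∏ t ∈ T, g t ω) * W ω) ∂P := by
          simp_rw [Finset.prod_insert ha, mul_assoc]
      _ = ∫ ω, (∏ t ∈ T, G t ω) * (G a ω * W ω) ∂P := by rw [h1, h2, ih hGW hGW1]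
      _ = ∫ ω, (∏ t ∈ insert a T, G t ω) * W ω ∂P := by
          simp_rw [Finset.prod_insert ha]
          congr 1 with ω
          ring

end Product

/-! ### Construction of the directing process -/

section Directing

variable {Ω C E : Type*} [mΩ : MeasurableSpace Ω] [mE : MeasurableSpace E]
  {P : Measure Ω} [IsProbabilityMeasure P] {d : C → C → ℝ} {X : C → Ω → E}

lemma sigmaOf_le (G : C → Kernel Ω E) : sigmaOf G ≤ mΩ :=
  iSup_le fun t => (G t).measurable.comap_le

lemma measurable_sigmaOf (G : C → Kernel Ω E) (t : C) :
    Measurable[sigmaOf G] (fun ω => G t ω) :=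
  measurable_iff_comap_le.2 (le_iSup (fun t => MeasurableSpace.comap (fun ω => G t ω) _) t)

lemma measurable_sigmaOf_pi (G : C → Kernel Ω E) [∀ t, IsMarkovKernel (G t)] (T : Finset C) :
    Measurable[sigmaOf G] (fun ω => Measure.pi fun t : T => G t ω) :=
  @measurable_measure_pi Ω E T _ (sigmaOf G) _ (fun t ω => G t ω) _
    fun t => measurable_sigmaOf G t

/-- For each fixed `B`, both sides integrated over `B` are finite measures in `A`. They agree on the
π-system of rectangles, hence everywhere. -/
lemma condExp_preimage_ae_eq_pi_of_rectangle (hX : ∀ t, Measurable (X t)) (G : C → Kernel Ω E)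
    [∀ t, IsMarkovKernel (G t)] (T : Finset C)
    (hrect : ∀ A : T → Set E, (∀ t, MeasurableSet (A t)) → ∀ B, MeasurableSet[sigmaOf G] B →
      P.real ((fun ω (t : T) => X t ω) ⁻¹' (Set.univ.pi A) ∩ B)
        = ∫ ω in B, ∏ t : T, (G t ω).real (A t) ∂P)
    {A : Set (T → E)} (hA : MeasurableSet A) :
    P[((fun ω (t : T) => X t ω) ⁻¹' A).indicator (fun _ => (1 : ℝ)) | sigmaOf G]
      =ᵐ[P] fun ω => (Measure.pi (fun t : T => G t ω)).real A := by
  have hm := sigmaOf_le G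
  have hXT : Measurable (fun ω (t : T) => X t ω) := measurable_pi_lambda _ fun t => hX t
  have hκ := measurable_sigmaOf_pi G T
  have hκ' := hκ.mono hm le_rfl
  have hκA : ∀ A : Set (T → E), MeasurableSet A →
      Measurable[sigmaOf G] fun ω => (Measure.pi (fun t : T => G t ω)).real A := fun A hA =>
    ENNReal.measurable_toReal.comp ((Measure.measurable_coe hA).comp hκ)
  have hint : ∀ A : Set (T → E), MeasurableSet A →
      Integrable (fun ω => (Measure.pi (fun t : T => G t ω)).real A) P := fun A hA =>
    Integrable.of_bound ((hκA A hA).mono hm le_rfl).aestronglyMeasurable 1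
      (Eventually.of_forall fun ω => by
        rw [Real.norm_of_nonneg measureReal_nonneg]
        exact measureReal_le_one)
  have hlint : ∀ A : Set (T → E), MeasurableSet A → ∀ B : Set Ω,
      ((P.restrict B).bind fun ω => Measure.pi fun t : T => G t ω) A
        = ENNReal.ofReal (∫ ω in B, (Measure.pi (fun t : T => G t ω)).real A ∂P) := by
    intro A hA B
    rw [Measure.bind_apply hA hκ'.aemeasurable, ofReal_integral_eq_lintegral_ofReal
      (hint A hA).integrableOn (Eventually.of_forall fun _ => measureReal_nonneg)]
    simp
  have heq : ∀ B, MeasurableSet[sigmaOf G] B →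
      (P.restrict B).map (fun ω (t : T) => X t ω)
        = (P.restrict B).bind fun ω => Measure.pi fun t : T => G t ω := by
    intro B hB
    have hrect' : ∀ A : T → Set E, (∀ t, MeasurableSet (A t)) →
        (P.restrict B).map (fun ω (t : T) => X t ω) (Set.univ.pi A)
          = ((P.restrict B).bind fun ω => Measure.pi fun t : T => G t ω) (Set.univ.pi A) := by
      intro A hA
      have hAm : MeasurableSet (Set.univ.pi A) := MeasurableSet.univ_pi hA
      rw [hlint _ hAm, Measure.map_apply hXT hAm, Measure.restrict_apply (hXT hAm)]
      simp_rw [measureReal_def, Measure.pi_pi, ENNReal.toReal_prod, ← measureReal_def]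
      rw [← hrect A hA B hB, ofReal_measureReal]
    have hfin : IsFiniteMeasure ((P.restrict B).map (fun ω (t : T) => X t ω)) := inferInstance
    refine ext_of_generate_finite _ generateFrom_pi.symm isPiSystem_pi ?_ ?_
    · rintro _ ⟨A, hA, rfl⟩
      exact hrect' A fun t => hA t trivial
    · have := hrect' (fun _ => Set.univ) fun _ => MeasurableSet.univ
      rwa [Set.pi_univ] at this
  symm
  refine ae_eq_condExp_of_forall_setIntegral_eq hm
    ((integrable_const _).indicator (hXT hA)) (fun _ _ _ => (hint A hA).integrableOn) ?_
    (hκA A hA).aestronglyMeasurable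
  intro B hB _
  have h1 := congrArg (fun μ => μ A) (heq B hB)
  simp only [hlint A hA B, Measure.map_apply hXT hA] at h1
  rw [integral_indicator_const _ (hXT hA), smul_eq_mul, mul_one, measureReal_def, h1,
    ENNReal.toReal_ofReal (integral_nonneg fun _ => measureReal_nonneg)]

theorem IsLocallyExchangeable.exists_isDirectingProcess [StandardBorelSpace E]
    (hexch : IsLocallyExchangeable d X P) (hd : IsPremetric d) (hsep : IsInfinitelySeparable d)
    (hX : ∀ t, Measurable (X t)) : ∃ G : C → Kernel Ω E, IsDirectingProcess d X P G := by
  classical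
  obtain ⟨S, hS, hu⟩ := hsep
  obtain ⟨f, hf⟩ := Set.countable_iff_exists_injOn.1 hS
  have h𝒯 := tailSigma_le hX S f
  have hΩ : Nonempty Ω := nonempty_of_isProbabilityMeasure P
  have hex : ∀ t : C, ∃ G : Kernel Ω E, IsMarkovKernel G ∧
      Measurable[tailSigma X S f] (fun ω => G ω) ∧ ∀ A, MeasurableSet A →
        (fun ω => (G ω).real A)
          =ᵐ[P] P[(X t ⁻¹' A).indicator (fun _ => (1 : ℝ))|tailSigma X S f] := fun t =>
    have : Nonempty E := ⟨X t hΩ.some⟩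
    exists_kernel_ae_eq_condExp h𝒯 (hX t)
  choose G hG hGm hGc using hex
  have hle : sigmaOf G ≤ tailSigma X S f := iSup_le fun t => (hGm t).comap_le
  have hGA : ∀ t {A : Set E}, MeasurableSet A →
      Measurable[tailSigma X S f] fun ω => (G t ω).real A := fun t A hA =>
    ENNReal.measurable_toReal.comp ((Measure.measurable_coe hA).comp (hGm t))
  have hG1 : ∀ t (A : Set E) ω, ‖(G t ω).real A‖ ≤ 1 := fun t A ω => by
    rw [Real.norm_of_nonneg measureReal_nonneg]
    exact measureReal_le_one
  have hGi : ∀ t {A : Set E}, MeasurableSet A → Integrable (fun ω => (G t ω).real A) P :=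
    fun t A hA => Integrable.of_bound ((hGA t hA).mono h𝒯 le_rfl).aestronglyMeasurable 1
      (Eventually.of_forall (hG1 t A))
  refine ⟨G, hG, fun T A hA => condExp_preimage_ae_eq_pi_of_rectangle hX G T ?_ hA,
    fun s t A hA => ?_⟩
  · intro A hA B hB
    have hBm := h𝒯 _ (hle _ hB)
    -- The product lemma takes factors indexed by all of `C`; the default outside `T` is irrelevant,
    -- as long as it is measurable.
    let A' : C → Set E := fun t => if ht : t ∈ T then A ⟨t, ht⟩ else Set.univ
    have hA' : ∀ t, MeasurableSet (A' t) := by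
      intro t
      by_cases ht : t ∈ T
      · simpa [A', ht] using hA ⟨t, ht⟩
      · simp [A', ht]
    have hAA' : ∀ t : T, A' t = A t := fun t => by simp [A']
    have hi1 : ∀ (Y : Set Ω) (ω : Ω), ‖Y.indicator (fun _ => (1 : ℝ)) ω‖ ≤ 1 := fun Y ω => by
      by_cases h : ω ∈ Y <;> simp [h]
    have key := integral_prod_mul_eq_of_condExp_coordSigma_compl (P := P) hX
      (tailSigma_le_coordSigma_compl X S f)
      (g := fun t => (X t ⁻¹' A' t).indicator (fun _ => (1 : ℝ)))
      (G := fun t ω => (G t ω).real (A' t))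
      (fun t => stronglyMeasurable_const.indicator
        (measurable_coordSigma X (Set.mem_singleton t) (hA' t)))
      (fun t => hi1 _) (fun t => (hGA t (hA' t)).stronglyMeasurable) (fun t => hG1 t (A' t))
      (fun t => by
        obtain ⟨u, h1, -, h2, h3⟩ := hu t
        exact (hexch.condExp_coordSigma_compl_ae_eq hd hX hf ⟨u, h1, h2, h3⟩ (hA' t)).trans
          (hGc t _ (hA' t)).symm)
      T (W := B.indicator fun _ => (1 : ℝ))
      (stronglyMeasurable_const.indicator
        (tailSigma_le_coordSigma_compl X S f T _ (hle _ hB))) (hi1 B)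
    have hXT : Measurable (fun ω (t : T) => X t ω) := measurable_pi_lambda _ fun t => hX t
    calc P.real ((fun ω (t : T) => X t ω) ⁻¹' (Set.univ.pi A) ∩ B)
        = ∫ ω, ((fun ω (t : T) => X t ω) ⁻¹' (Set.univ.pi A) ∩ B).indicator
            (fun _ => (1 : ℝ)) ω ∂P := by
          rw [integral_indicator_const _ ((hXT (MeasurableSet.univ_pi hA)).inter hBm), smul_eq_mul,
            mul_one]
      _ = ∫ ω, (∏ t ∈ T, (X t ⁻¹' A' t).indicator (fun _ => (1 : ℝ)) ω)
            * B.indicator (fun _ => (1 : ℝ)) ω ∂P := by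
          congr 1 with ω
          rw [← Finset.prod_coe_sort]
          simp only [Set.indicator_apply, Finset.prod_ite_zero, hAA', Finset.prod_const_one]
          simp [ite_and, and_comm]
      _ = ∫ ω, (∏ t ∈ T, (G t ω).real (A' t)) * B.indicator (fun _ => (1 : ℝ)) ω ∂P := key
      _ = ∫ ω in B, ∏ t : T, (G t ω).real (A t) ∂P := by
          rw [← integral_indicator hBm]
          congr 1 with ω
          rw [← Finset.prod_coe_sort]
          by_cases h : ω ∈ B <;> simp [h, hAA']
  · have hset : ∀ r (B : Set Ω), MeasurableSet[tailSigma X S f] B →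
        ∫ ω in B, (G r ω).real A ∂P = P.real (X r ⁻¹' A ∩ B) := by
      intro r B hB
      rw [setIntegral_congr_ae (h𝒯 _ hB) ((hGc r A hA).mono fun ω h _ => h),
        setIntegral_condExp h𝒯 ((integrable_const _).indicator (hX r hA)) hB,
        integral_indicator_const _ (hX r hA), smul_eq_mul, mul_one,
        measureReal_restrict_apply (hX r hA)]
    -- Testing `A` on `B` and `Aᶜ` on `Bᶜ` turns the expected absolute difference into a difference
    -- of probabilities. As a tail event, `B` involves neither `X s` nor `X t`, as the
    -- exchangeability bound requires.
    let B : Set Ω := {ω | (G t ω).real A ≤ (G s ω).real A}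
    have hB : MeasurableSet[tailSigma X S f] B :=
      @measurableSet_le _ _ _ _ _ (tailSigma X S f) _ _ _ _ _ (hGA t hA) (hGA s hA)
    have hBm := h𝒯 _ hB
    have hsw : ∀ r, P.real (switched X A B Bᶜ r)
        = P.real (X r ⁻¹' A ∩ B) + (P.real Bᶜ - P.real (X r ⁻¹' A ∩ Bᶜ)) := by
      intro r
      rw [switched, measureReal_union (Set.disjoint_left.2 fun ω h h' => h'.1 h.1)
        ((hX r hA.compl).inter hBm.compl)]
      have := measureReal_inter_add_sdiff (μ := P) (s := Bᶜ) (hX r hA)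
      rw [Set.inter_comm (X r ⁻¹' A) Bᶜ, Set.preimage_compl, Set.inter_comm _ Bᶜ,
        ← Set.sdiff_eq]
      linarith
    have key := hexch.abs_measureReal_switched_sub_le hd hX (s := s) (t := t) hA (B := B) (by
      refine coordSigma_mono X ?_ _ (tailSigma_le_coordSigma_compl X S f {s, t} _ hB)
      rw [Finset.coe_pair])
    have hi := (hGi s hA).sub (hGi t hA)
    have h1 : ∫ ω in B, |(G s ω).real A - (G t ω).real A| ∂P
        = ∫ ω in B, (G s ω).real A ∂P - ∫ ω in B, (G t ω).real A ∂P := by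
      rw [← integral_sub (hGi s hA).integrableOn (hGi t hA).integrableOn]
      exact setIntegral_congr_fun hBm fun ω hω => abs_of_nonneg (sub_nonneg.2 hω)
    have h2 : ∫ ω in Bᶜ, |(G s ω).real A - (G t ω).real A| ∂P
        = ∫ ω in Bᶜ, (G t ω).real A ∂P - ∫ ω in Bᶜ, (G s ω).real A ∂P := by
      rw [← integral_sub (hGi t hA).integrableOn (hGi s hA).integrableOn]
      refine setIntegral_congr_fun hBm.compl fun ω hω => ?_
      change |(G s ω).real A - (G t ω).real A| = (G t ω).real A - (G s ω).real A
      rw [abs_of_nonpos (sub_nonpos.2 (le_of_not_ge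
        (show ¬ (G t ω).real A ≤ (G s ω).real A from hω))), neg_sub]
    rw [← integral_add_compl hBm (f := fun ω => |(G s ω).real A - (G t ω).real A|) hi.abs,
      h1, h2, hset s B hB, hset t B hB, hset t _ (@MeasurableSet.compl _ _ _ hB),
      hset s _ (@MeasurableSet.compl _ _ _ hB)]
    rw [hsw, hsw] at key
    linarith [(abs_le.1 key).2]

end Directing

/-! ### Hoeffding and variance bounds for independent observations -/

section ProductMeasure

variable {E ι : Type*} [Fintype ι] [MeasurableSpace E] {μ : ι → Measure E}
  [∀ i, IsProbabilityMeasure (μ i)]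

lemma measureReal_pi_le_sum_sub_integral_le {f : ι → E → ℝ} (hf : ∀ i, Measurable (f i))
    {a b : ι → ℝ} (hab : ∀ i x, f i x ∈ Set.Icc (a i) (b i)) {ε : ℝ} (hε : 0 ≤ ε) :
    (Measure.pi μ).real {x | ε ≤ ∑ i, (f i (x i) - ∫ y, f i y ∂(μ i))}
      ≤ Real.exp (-(2 * ε ^ 2) / ∑ i, (b i - a i) ^ 2) := by
  have hind : iIndepFun (fun i (x : ι → E) => f i (x i) - ∫ y, f i y ∂(μ i)) (Measure.pi μ) :=
    iIndepFun_pi (X := fun i y => f i y - ∫ y, f i y ∂(μ i))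
      fun i => ((hf i).sub_const _).aemeasurable
  have hsub : ∀ i ∈ Finset.univ, HasSubgaussianMGF
      (fun x : ι → E => f i (x i) - ∫ y, f i y ∂(μ i)) ((‖b i - a i‖₊ / 2) ^ 2)
      (Measure.pi μ) := by
    intro i _
    rw [← integral_comp_eval (μ := μ) (hf i).aestronglyMeasurable]
    exact hasSubgaussianMGF_of_mem_Icc ((hf i).comp (measurable_pi_apply i)).aemeasurable
      (Eventually.of_forall fun x => hab i (x i))
  refine (HasSubgaussianMGF.measure_sum_ge_le_of_iIndepFun hind hsub hε).trans_eq ?_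
  congr 1
  push_cast
  simp_rw [div_pow, Real.norm_eq_abs, sq_abs, ← Finset.sum_div]
  ring

variable {h : E → ℝ} {w : ι → ℝ}

lemma measureReal_pi_le_abs_sum_sub_sum_integral_le (hh : Measurable h)
    (h01 : ∀ x, h x ∈ Set.Icc (0 : ℝ) 1) (hw : ∀ i, 0 ≤ w i) {ε : ℝ} (hε : 0 ≤ ε) :
    (Measure.pi μ).real {x | ε ≤ |∑ i, w i * h (x i) - ∑ i, w i * ∫ y, h y ∂(μ i)|}
      ≤ 2 * Real.exp (-(2 * ε ^ 2) / ∑ i, w i ^ 2) := by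
  have h1 := measureReal_pi_le_sum_sub_integral_le (μ := μ) (f := fun i y => w i * h y)
    (fun i => hh.const_mul _) (a := 0) (b := w)
    (fun i x => ⟨mul_nonneg (hw i) (h01 x).1, mul_le_of_le_one_right (hw i) (h01 x).2⟩) hε
  have h2 := measureReal_pi_le_sum_sub_integral_le (μ := μ) (f := fun i y => -(w i * h y))
    (fun i => (hh.const_mul _).neg) (a := -w) (b := 0)
    (fun i x => ⟨neg_le_neg (mul_le_of_le_one_right (hw i) (h01 x).2),
      neg_nonpos.2 (mul_nonneg (hw i) (h01 x).1)⟩) hε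
  simp only [Pi.zero_apply, Pi.neg_apply, sub_zero, zero_sub, neg_neg, integral_neg,
    integral_const_mul] at h1 h2
  rw [two_mul (Real.exp _)]
  refine (measureReal_mono ?_).trans ((measureReal_union_le _ _).trans (add_le_add h1 h2))
  intro x hx
  rcases le_abs.1 (show ε ≤ |_| from hx) with h | h
  · left
    simpa only [Set.mem_ofPred_eq, Finset.sum_sub_distrib] using h
  · right
    simp only [Set.mem_ofPred_eq, Finset.sum_sub_distrib, Finset.sum_neg_distrib]
    linarith

lemma sum_mul_mem_Icc (hw : ∀ i, 0 ≤ w i) (hw1 : ∑ i, w i = 1) {y : ι → ℝ}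
    (hy : ∀ i, y i ∈ Set.Icc (0 : ℝ) 1) : ∑ i, w i * y i ∈ Set.Icc (0 : ℝ) 1 :=
  ⟨Finset.sum_nonneg fun i _ => mul_nonneg (hw i) (hy i).1,
    hw1 ▸ Finset.sum_le_sum fun i _ => mul_le_of_le_one_right (hw i) (hy i).2⟩

lemma integral_mem_Icc {ν : Measure E} [IsProbabilityMeasure ν] (hh : Measurable h)
    (h01 : ∀ x, h x ∈ Set.Icc (0 : ℝ) 1) : ∫ x, h x ∂ν ∈ Set.Icc (0 : ℝ) 1 := by
  refine ⟨integral_nonneg fun x => (h01 x).1, ?_⟩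
  have := integral_mono (Integrable.of_mem_Icc (μ := ν) 0 1 hh.aemeasurable
    (Eventually.of_forall h01)) (integrable_const 1) fun x => (h01 x).2
  simpa using this

/-- Bias-variance decomposition around the constant `c`: variances add under the product measure,
and a variable with values in `[0, 1]` has variance at most `1/4`. -/
lemma integral_pi_sum_sub_sq_le (hh : Measurable h) (h01 : ∀ x, h x ∈ Set.Icc (0 : ℝ) 1)
    (c : ℝ) :
    ∫ x, (∑ i, w i * h (x i) - c) ^ 2 ∂(Measure.pi μ)
      ≤ 1 / 4 * ∑ i, w i ^ 2 + (∑ i, w i * ∫ y, h y ∂(μ i) - c) ^ 2 := by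
  have hL : ∀ i, MemLp (fun y => w i * h y) 2 (μ i) := fun i =>
    (memLp_of_bounded (Eventually.of_forall h01) hh.aestronglyMeasurable 2).const_mul _
  have hLπ : ∀ i, MemLp (fun x : ι → E => w i * h (x i)) 2 (Measure.pi μ) := fun i =>
    (hL i).comp_measurePreserving (measurePreserving_eval μ i)
  set Y : (ι → E) → ℝ := fun x => ∑ i, w i * h (x i) with hY
  have hYL : MemLp Y 2 (Measure.pi μ) := memLp_finsetSum _ fun i _ => hLπ i
  have hvar : Var[Y; Measure.pi μ] ≤ 1 / 4 * ∑ i, w i ^ 2 := by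
    have h1 := variance_sum_pi (μ := μ) (X := fun i y => w i * h y) hL
    have h2 : (∑ i, fun x : ι → E => w i * h (x i)) = Y := by
      ext x
      simp [hY]
    rw [← h2, h1, Finset.mul_sum]
    refine Finset.sum_le_sum fun i _ => ?_
    rw [variance_const_mul, mul_comm]
    refine mul_le_mul_of_nonneg_right ?_ (sq_nonneg _)
    refine (variance_le_sq_of_bounded (Eventually.of_forall h01) hh.aemeasurable).trans_eq ?_
    norm_num
  have hmean : ∫ x, Y x ∂(Measure.pi μ) = ∑ i, w i * ∫ y, h y ∂(μ i) := by
    rw [integral_finsetSum _ fun i _ => (hLπ i).integrable one_le_two]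
    refine Finset.sum_congr rfl fun i _ => ?_
    rw [integral_const_mul, integral_comp_eval (μ := μ) (i := i) (f := h) hh.aestronglyMeasurable]
  have hYc : MemLp (fun x => Y x - c) 2 (Measure.pi μ) := hYL.sub (memLp_const c)
  have h3 := variance_eq_sub hYc
  rw [variance_sub_const hYL.aestronglyMeasurable,
    integral_sub (hYL.integrable one_le_two) (integrable_const c), hmean] at h3
  simp only [Pi.pow_apply, integral_const, probReal_univ, one_smul] at h3
  linarith

end ProductMeasure

/-! ### Disintegration along the conditioning variable -/

section Mixture

variable {Ω Γ Y : Type*} [MeasurableSpace Ω] [mΓ : MeasurableSpace Γ] [MeasurableSpace Y]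
  {P : Measure Ω} [IsProbabilityMeasure P] {Z : Ω → Γ} {V : Ω → Y} {κ : Kernel Γ Y}
  [IsMarkovKernel κ]

/-- The defining integrals of the conditional expectation over `Z ⁻¹' s` are the masses of the
rectangles `s ×ˢ A`, and these determine the joint law. -/
lemma map_prodMk_eq_compProd (hZ : Measurable Z) (hV : Measurable V)
    (hκ : ∀ A, MeasurableSet A →
      P[(V ⁻¹' A).indicator (fun _ => (1 : ℝ))|mΓ.comap Z] =ᵐ[P] fun ω => (κ (Z ω)).real A) :
    P.map (fun ω => (Z ω, V ω)) = P.map Z ⊗ₘ κ := by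
  have : IsProbabilityMeasure (P.map Z) := Measure.isProbabilityMeasure_map hZ.aemeasurable
  refine Measure.ext_prod fun {s A} hs hA => ?_
  have hκA : Measurable fun ω => (κ (Z ω)).real A :=
    ENNReal.measurable_toReal.comp ((κ.measurable_coe hA).comp hZ)
  rw [Measure.compProd_apply_prod hs hA, Measure.map_apply (hZ.prodMk hV) (hs.prod hA),
    setLIntegral_map hs (κ.measurable_coe hA) hZ]
  have hI := setIntegral_condExp hZ.comap_le (μ := P)
    ((integrable_const (1 : ℝ)).indicator (hV hA)) (s := Z ⁻¹' s) ⟨s, hs, rfl⟩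
  rw [setIntegral_congr_ae (hZ hs) ((hκ A hA).mono fun ω h _ => h),
    integral_indicator_const _ (hV hA), smul_eq_mul, mul_one,
    measureReal_restrict_apply (hV hA)] at hI
  have hint : Integrable (fun ω => (κ (Z ω)).real A) P :=
    Integrable.of_bound hκA.aestronglyMeasurable 1 (Eventually.of_forall fun ω => by
      rw [Real.norm_of_nonneg measureReal_nonneg]
      exact measureReal_le_one)
  have hlint : ∫⁻ ω in Z ⁻¹' s, κ (Z ω) A ∂P
      = ENNReal.ofReal (∫ ω in Z ⁻¹' s, (κ (Z ω)).real A ∂P) := by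
    rw [ofReal_integral_eq_lintegral_ofReal hint.integrableOn
      (Eventually.of_forall fun _ => measureReal_nonneg)]
    simp
  rw [hlint, hI, ofReal_measureReal, Set.mk_preimage_prod, Set.inter_comm]

lemma integral_eq_integral_integral_of_map_eq_compProd (hZ : Measurable Z) (hV : Measurable V)
    (hκ : P.map (fun ω => (Z ω, V ω)) = P.map Z ⊗ₘ κ) {F : Γ × Y → ℝ} (hF : Measurable F)
    {R : ℝ} (hR : ∀ p, ‖F p‖ ≤ R) :
    ∫ ω, F (Z ω, V ω) ∂P = ∫ ω, ∫ y, F (Z ω, y) ∂(κ (Z ω)) ∂P := by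
  have : IsProbabilityMeasure (P.map Z) := Measure.isProbabilityMeasure_map hZ.aemeasurable
  rw [← integral_map (f := F) (hZ.prodMk hV).aemeasurable hF.aestronglyMeasurable, hκ,
    Measure.integral_compProd
      (Integrable.of_bound hF.aestronglyMeasurable R (Eventually.of_forall hR)),
    integral_map hZ.aemeasurable
      hF.stronglyMeasurable.integral_kernel_prod_right'.aestronglyMeasurable]

lemma measureReal_le_of_map_eq_compProd (hZ : Measurable Z) (hV : Measurable V)
    (hκ : P.map (fun ω => (Z ω, V ω)) = P.map Z ⊗ₘ κ) {D : Set (Γ × Y)} (hD : MeasurableSet D)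
    {c : ℝ} (hc : ∀ z, (κ z).real {y | (z, y) ∈ D} ≤ c) :
    P.real {ω | (Z ω, V ω) ∈ D} ≤ c := by
  have : IsProbabilityMeasure (P.map Z) := Measure.isProbabilityMeasure_map hZ.aemeasurable
  obtain ⟨ω₀⟩ := nonempty_of_isProbabilityMeasure P
  have hc0 : 0 ≤ c := measureReal_nonneg.trans (hc (Z ω₀))
  have h1 : P {ω | (Z ω, V ω) ∈ D} = (P.map Z ⊗ₘ κ) D := by
    rw [← hκ, Measure.map_apply (hZ.prodMk hV) hD]
    rfl
  refine ENNReal.toReal_le_of_le_ofReal hc0 ?_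
  rw [h1, Measure.compProd_apply hD]
  calc ∫⁻ z, κ z (Prod.mk z ⁻¹' D) ∂(P.map Z) ≤ ∫⁻ _, ENNReal.ofReal c ∂(P.map Z) :=
        lintegral_mono fun z =>
          (ENNReal.le_ofReal_iff_toReal_le (measure_ne_top _ _) hc0).2 (hc z)
    _ = ENNReal.ofReal c := by simp

end Mixture

/-! ### Weighted empirical means under a mixture of products -/

section Empirical

variable {Ω Γ E ι : Type*} [Fintype ι] [MeasurableSpace Ω] [mΓ : MeasurableSpace Γ]
  [MeasurableSpace E] {P : Measure Ω} [IsProbabilityMeasure P] {Z : Ω → Γ} {V : Ω → ι → E}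

/-- The product of finitely many Markov kernels with a common source. -/
noncomputable def piKernel (K : ι → Kernel Γ E) [∀ i, IsMarkovKernel (K i)] : Kernel Γ (ι → E) :=
  ⟨fun z => Measure.pi fun i => K i z, measurable_measure_pi fun i => (K i).measurable⟩

instance (K : ι → Kernel Γ E) [∀ i, IsMarkovKernel (K i)] : IsMarkovKernel (piKernel K) :=
  ⟨fun z => inferInstanceAs (IsProbabilityMeasure (Measure.pi fun i => K i z))⟩

variable {K : ι → Kernel Γ E} [∀ i, IsMarkovKernel (K i)] {h : E → ℝ} {w : ι → ℝ}

lemma integral_sum_sub_sq_le (hZ : Measurable Z) (hV : Measurable V)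
    (hκ : P.map (fun ω => (Z ω, V ω)) = P.map Z ⊗ₘ piKernel K) (hh : Measurable h)
    (h01 : ∀ x, h x ∈ Set.Icc (0 : ℝ) 1) (hw : ∀ i, 0 ≤ w i) (hw1 : ∑ i, w i = 1)
    {c : Γ → ℝ} (hc : Measurable c) (hc01 : ∀ z, c z ∈ Set.Icc (0 : ℝ) 1) :
    ∫ ω, (∑ i, w i * h (V ω i) - c (Z ω)) ^ 2 ∂P
      ≤ 1 / 4 * ∑ i, w i ^ 2 + ∫ ω, (∑ i, w i * ∫ y, h y ∂(K i (Z ω)) - c (Z ω)) ^ 2 ∂P := by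
  have hsq : ∀ {a b : ℝ}, a ∈ Set.Icc (0 : ℝ) 1 → b ∈ Set.Icc (0 : ℝ) 1 →
      ‖(a - b) ^ 2‖ ≤ 1 := by
    rintro a b ⟨h1, h2⟩ ⟨h3, h4⟩
    rw [norm_pow, Real.norm_eq_abs]
    exact pow_le_one₀ (abs_nonneg _) (abs_le.2 ⟨by linarith, by linarith⟩)
  let F : Γ × (ι → E) → ℝ := fun p => (∑ i, w i * h (p.2 i) - c p.1) ^ 2
  have hF : Measurable F := by fun_prop
  have hF1 : ∀ p, ‖F p‖ ≤ 1 := fun p => hsq (sum_mul_mem_Icc hw hw1 fun i => h01 _) (hc01 _)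
  have hKm : Measurable fun ω => (∑ i, w i * ∫ y, h y ∂(K i (Z ω)) - c (Z ω)) ^ 2 :=
    ((Finset.measurable_sum _ fun i _ =>
      ((hh.stronglyMeasurable.integral_kernel (κ := K i)).measurable.comp hZ).const_mul _).sub
        (hc.comp hZ)).pow_const 2
  have hKi : Integrable (fun ω => (∑ i, w i * ∫ y, h y ∂(K i (Z ω)) - c (Z ω)) ^ 2) P :=
    Integrable.of_bound hKm.aestronglyMeasurable 1 (Eventually.of_forall fun ω =>
      hsq (sum_mul_mem_Icc hw hw1 fun i => integral_mem_Icc hh h01) (hc01 _))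
  have hIm : Integrable (fun ω => ∫ y, F (Z ω, y) ∂(piKernel K (Z ω))) P := by
    refine Integrable.of_bound (hF.stronglyMeasurable.integral_kernel_prod_right'.comp_measurable
      hZ).aestronglyMeasurable 1 (Eventually.of_forall fun ω => ?_)
    simpa using norm_integral_le_of_norm_le_const (μ := piKernel K (Z ω))
      (Eventually.of_forall fun y => hF1 (Z ω, y))
  calc ∫ ω, (∑ i, w i * h (V ω i) - c (Z ω)) ^ 2 ∂P
      = ∫ ω, ∫ y, F (Z ω, y) ∂(piKernel K (Z ω)) ∂P :=
        integral_eq_integral_integral_of_map_eq_compProd hZ hV hκ hF hF1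
    _ ≤ ∫ ω, (1 / 4 * ∑ i, w i ^ 2
          + (∑ i, w i * ∫ y, h y ∂(K i (Z ω)) - c (Z ω)) ^ 2) ∂P :=
        integral_mono hIm ((integrable_const _).add hKi) fun ω =>
          integral_pi_sum_sub_sq_le (μ := fun i => K i (Z ω)) (w := w) hh h01 (c (Z ω))
    _ = _ := by
        rw [integral_add (integrable_const _) hKi]
        simp

lemma measureReal_le_abs_sum_sub_le (hZ : Measurable Z) (hV : Measurable V)
    (hκ : P.map (fun ω => (Z ω, V ω)) = P.map Z ⊗ₘ piKernel K) (hh : Measurable h)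
    (h01 : ∀ x, h x ∈ Set.Icc (0 : ℝ) 1) (hw : ∀ i, 0 ≤ w i) {ε : ℝ} (hε : 0 ≤ ε) :
    P.real {ω | ε ≤ |∑ i, w i * h (V ω i) - ∑ i, w i * ∫ y, h y ∂(K i (Z ω))|}
      ≤ 2 * Real.exp (-(2 * ε ^ 2) / ∑ i, w i ^ 2) := by
  have hK : ∀ i, Measurable fun z => ∫ y, h y ∂(K i z) := fun i =>
    (hh.stronglyMeasurable.integral_kernel (κ := K i)).measurable
  refine measureReal_le_of_map_eq_compProd hZ hV hκ
    (D := {p | ε ≤ |∑ i, w i * h (p.2 i) - ∑ i, w i * ∫ y, h y ∂(K i p.1)|}) ?_ fun z =>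
      measureReal_pi_le_abs_sum_sub_sum_integral_le (μ := fun i => K i z) hh h01 hw hε
  have hm1 : Measurable fun p : Γ × (ι → E) => ∑ i, w i * h (p.2 i) := by fun_prop
  have hm2 : Measurable fun p : Γ × (ι → E) => ∑ i, w i * ∫ y, h y ∂(K i p.1) :=
    Finset.measurable_sum _ fun i _ => ((hK i).comp measurable_fst).const_mul _
  exact measurableSet_le measurable_const (hm1.sub hm2).abs

end Empirical

/-! ### Smoothness of the directing process tested on functions -/

section Smoothness

variable {Ω C E : Type*} [MeasurableSpace Ω] [MeasurableSpace E] {P : Measure Ω}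
  [IsProbabilityMeasure P] {d : C → C → ℝ} {X : C → Ω → E} {G : C → Kernel Ω E} {h : E → ℝ}

lemma integral_simpleFunc_eq_sum (ν : Measure E) [IsFiniteMeasure ν] (f : SimpleFunc E ℝ) :
    ∫ x, f x ∂ν = ∑ y ∈ f.range, y * ν.real (f ⁻¹' {y}) := by
  rw [← f.integral_eq_integral (f.integrable_of_isFiniteMeasure), f.integral_eq]
  simp_rw [smul_eq_mul, mul_comm]

lemma IsDirectingProcess.integral_abs_simpleFunc_sub_le (hG : IsDirectingProcess d X P G)
    {f : SimpleFunc E ℝ} (hf : ∀ x, f x ∈ Set.Icc (0 : ℝ) 1) (s t : C) :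
    ∫ ω, |∫ x, f x ∂(G s ω) - ∫ x, f x ∂(G t ω)| ∂P ≤ levelSum f * d s t := by
  have := hG.isMarkov
  have hm : ∀ r (y : ℝ), Measurable fun ω => (G r ω).real (f ⁻¹' {y}) := fun r y =>
    ENNReal.measurable_toReal.comp ((G r).measurable_coe (f.measurableSet_fiber y))
  have hi : ∀ r (y : ℝ), Integrable (fun ω => (G r ω).real (f ⁻¹' {y})) P := fun r y =>
    Integrable.of_bound (hm r y).aestronglyMeasurable 1 (Eventually.of_forall fun ω => by
      rw [Real.norm_of_nonneg measureReal_nonneg]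
      exact measureReal_le_one)
  have hy : ∀ y ∈ f.range, 0 ≤ y := by
    intro y hy
    obtain ⟨x, rfl⟩ := SimpleFunc.mem_range.1 hy
    exact (hf x).1
  have hi' : ∀ y ∈ f.range, Integrable
      (fun ω => y * |(G s ω).real (f ⁻¹' {y}) - (G t ω).real (f ⁻¹' {y})|) P := fun y _ =>
    ((hi s y).sub (hi t y)).abs.const_mul y
  have hptw : ∀ ω, |∫ x, f x ∂(G s ω) - ∫ x, f x ∂(G t ω)|
      ≤ ∑ y ∈ f.range, y * |(G s ω).real (f ⁻¹' {y}) - (G t ω).real (f ⁻¹' {y})| := by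
    intro ω
    simp_rw [integral_simpleFunc_eq_sum, ← Finset.sum_sub_distrib, ← mul_sub]
    refine (Finset.abs_sum_le_sum_abs _ _).trans (Finset.sum_le_sum fun y hyr => ?_)
    rw [abs_mul, abs_of_nonneg (hy y hyr)]
  calc ∫ ω, |∫ x, f x ∂(G s ω) - ∫ x, f x ∂(G t ω)| ∂P
      ≤ ∫ ω, ∑ y ∈ f.range, y * |(G s ω).real (f ⁻¹' {y}) - (G t ω).real (f ⁻¹' {y})| ∂P :=
        integral_mono_of_nonneg (Eventually.of_forall fun ω => abs_nonneg _)
          (integrable_finsetSum _ hi') (Eventually.of_forall hptw)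
    _ = ∑ y ∈ f.range, y * ∫ ω, |(G s ω).real (f ⁻¹' {y}) - (G t ω).real (f ⁻¹' {y})| ∂P := by
        rw [integral_finsetSum _ hi']
        simp_rw [integral_const_mul]
    _ ≤ ∑ y ∈ f.range, y * d s t := Finset.sum_le_sum fun y hyr =>
        mul_le_mul_of_nonneg_left (hG.smooth s t _ (f.measurableSet_fiber y)) (hy y hyr)
    _ = levelSum f * d s t := by rw [levelSum, Finset.sum_mul]

lemma integrable_integral_kernel (hG : IsDirectingProcess d X P G) (hh : Measurable h)
    (h01 : ∀ x, h x ∈ Set.Icc (0 : ℝ) 1) (t : C) :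
    Integrable (fun ω => ∫ x, h x ∂(G t ω)) P := by
  have := hG.isMarkov
  exact Integrable.of_mem_Icc 0 1 (hh.stronglyMeasurable.integral_kernel).measurable.aemeasurable
    (Eventually.of_forall fun ω => integral_mem_Icc hh h01)

/-- Replacing `h` by a simple function `f` costs the sup distance twice, once for `G s` and once for
`G t`. The integral of `f` is a combination of level-set masses, each smooth in the covariate. -/
lemma IsDirectingProcess.integral_abs_sub_le_approxCoeff (hG : IsDirectingProcess d X P G)
    (hh : Measurable h) (h01 : ∀ x, h x ∈ Set.Icc (0 : ℝ) 1) (s t : C) :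
    ∫ ω, |∫ x, h x ∂(G s ω) - ∫ x, h x ∂(G t ω)| ∂P ≤ approxCoeff d h s t := by
  have := hG.isMarkov
  have hne : Nonempty {f : SimpleFunc E ℝ // ∀ x, f x ∈ Set.Icc (0 : ℝ) 1} :=
    ⟨⟨0, fun x => by simp⟩⟩
  refine le_ciInf fun ⟨f, hf⟩ => ?_
  have hfm : Measurable f := f.measurable
  have hbdd : BddAbove (Set.range fun x => |h x - f x|) := by
    refine ⟨1, ?_⟩
    rintro _ ⟨x, rfl⟩
    exact abs_le.2 ⟨by linarith [(h01 x).1, (hf x).2], by linarith [(h01 x).2, (hf x).1]⟩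
  have hdiff : ∀ r ω, |∫ x, h x ∂(G r ω) - ∫ x, f x ∂(G r ω)| ≤ ⨆ x, |h x - f x| := by
    intro r ω
    rw [← integral_sub (Integrable.of_mem_Icc 0 1 hh.aemeasurable (Eventually.of_forall h01))
      (Integrable.of_mem_Icc 0 1 hfm.aemeasurable (Eventually.of_forall hf))]
    simpa using norm_integral_le_of_norm_le_const (μ := G r ω) (f := fun x => h x - f x)
      (Eventually.of_forall fun x => le_ciSup hbdd x)
  have hif := ((integrable_integral_kernel hG hfm hf s).sub
    (integrable_integral_kernel hG hfm hf t)).abs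
  calc ∫ ω, |∫ x, h x ∂(G s ω) - ∫ x, h x ∂(G t ω)| ∂P
      ≤ ∫ ω, (|∫ x, f x ∂(G s ω) - ∫ x, f x ∂(G t ω)| + 2 * ⨆ x, |h x - f x|) ∂P := by
        refine integral_mono_of_nonneg (Eventually.of_forall fun ω => abs_nonneg _)
          (hif.add (integrable_const _)) (Eventually.of_forall fun ω => ?_)
        have h1 := abs_le.1 (hdiff s ω)
        have h2 := abs_le.1 (hdiff t ω)
        have h3 := abs_le.1 (le_refl |∫ x, f x ∂(G s ω) - ∫ x, f x ∂(G t ω)|)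
        exact abs_le.2 ⟨by linarith, by linarith⟩
    _ = ∫ ω, |∫ x, f x ∂(G s ω) - ∫ x, f x ∂(G t ω)| ∂P + 2 * ⨆ x, |h x - f x| := by
        rw [integral_add (f := fun ω => |∫ x, f x ∂(G s ω) - ∫ x, f x ∂(G t ω)|) hif
          (integrable_const _)]
        simp
    _ ≤ _ := by gcongr; exact hG.integral_abs_simpleFunc_sub_le hf s t

end Smoothness

/-! ### Fluctuation and bias of the local empirical measure -/

section Estimation

variable {Ω C E : Type*} [MeasurableSpace E] {X : C → Ω → E} {h : E → ℝ} {T : Finset C}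
  {ξ : C → C → ℝ}

lemma integral_localEmpirical (hξ : IsWeighting T ξ) (hh : Measurable h) (τ : C) (ω : Ω) :
    ∫ x, h x ∂(localEmpirical X T ξ τ ω) = ∑ t : T, ξ t τ * h (X t ω) := by
  have hi : ∀ t, Integrable h (Measure.dirac (X t ω)) := fun t =>
    integrable_dirac' hh.stronglyMeasurable enorm_lt_top
  rw [localEmpirical, integral_finsetSum_measure fun t _ =>
    (hi t).smul_measure ENNReal.ofReal_ne_top, ← Finset.sum_coe_sort]
  refine Finset.sum_congr rfl fun t _ => ?_
  rw [integral_smul_measure, integral_dirac' _ _ hh.stronglyMeasurable,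
    ENNReal.toReal_ofReal (hξ.mem_Icc t t.2 τ).1, smul_eq_mul]

variable [mΩ : MeasurableSpace Ω] {P : Measure Ω} {d : C → C → ℝ} {G : C → Kernel Ω E}

/-- The directing process as kernels on the σ-algebra it generates. -/
def generatedKernel (G : C → Kernel Ω E) (t : C) : @Kernel Ω E (sigmaOf G) _ :=
  @Kernel.mk Ω E (sigmaOf G) _ (fun ω => G t ω) (measurable_sigmaOf G t)

lemma IsDirectingProcess.isMarkovKernel_generatedKernel (hG : IsDirectingProcess d X P G) (t : C) :
    @IsMarkovKernel Ω E (sigmaOf G) _ (generatedKernel G t) :=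
  @IsMarkovKernel.mk Ω E (sigmaOf G) _ _ fun ω => (hG.isMarkov t).isProbabilityMeasure ω

variable [IsProbabilityMeasure P]

/-- The conditioning variable is the identity from `Ω` to `Ω` equipped with `sigmaOf G`: it
generates exactly `sigmaOf G`, so `condLaw` is the required conditional law. The two σ-algebras on
`Ω` force the explicit arguments. -/
lemma IsDirectingProcess.map_prodMk_eq_compProd (hG : IsDirectingProcess d X P G)
    (hX : ∀ t, Measurable (X t)) (T : Finset C) :
    letI := fun t : T => hG.isMarkovKernel_generatedKernel t
    @Measure.map _ _ mΩ (@Prod.instMeasurableSpace _ _ (sigmaOf G) _)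
        (fun ω => (ω, fun t : T => X t ω)) P
      = @Measure.compProd _ _ (sigmaOf G) _ (@Measure.map _ _ mΩ (sigmaOf G) id P)
        (@piKernel Ω E T _ (sigmaOf G) _ (fun t : T => generatedKernel G t) _) := by
  have inst := fun t : T => hG.isMarkovKernel_generatedKernel t
  refine @LocalExch.map_prodMk_eq_compProd Ω Ω (T → E) mΩ (sigmaOf G) _ P _ id
    (fun ω (t : T) => X t ω) _ _ (measurable_id'' (sigmaOf_le G))
    (measurable_pi_lambda _ fun t => hX t) ?_
  intro A hA
  rw [MeasurableSpace.comap_id]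
  exact hG.condLaw T A hA

lemma IsDirectingProcess.integral_sum_sub_sq_le
    (hG : IsDirectingProcess d X P G) (hX : ∀ t, Measurable (X t)) (hξ : IsWeighting T ξ)
    (hh : Measurable h) (h01 : ∀ x, h x ∈ Set.Icc (0 : ℝ) 1) (τ : C) :
    ∫ ω, (∑ t : T, ξ t τ * h (X t ω) - ∫ x, h x ∂(G τ ω)) ^ 2 ∂P
      ≤ 1 / 4 * ∑ t : T, ξ t τ ^ 2
        + ∫ ω, (∑ t : T, ξ t τ * ∫ x, h x ∂(G t ω) - ∫ x, h x ∂(G τ ω)) ^ 2 ∂P := by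
  have inst := fun t : T => hG.isMarkovKernel_generatedKernel t
  have hτ := hG.isMarkov τ
  have hc : Measurable[sigmaOf G] fun ω => ∫ x, h x ∂(G τ ω) :=
    (@StronglyMeasurable.integral_kernel Ω E (sigmaOf G) _ (generatedKernel G τ) ℝ _ _ h
      hh.stronglyMeasurable).measurable
  exact @LocalExch.integral_sum_sub_sq_le Ω Ω E T _ mΩ (sigmaOf G) _ P _ id
    (fun ω t => X t ω) (fun t => generatedKernel G t) inst h (fun t => ξ t τ)
    (measurable_id'' (sigmaOf_le G)) (measurable_pi_lambda _ fun t => hX t)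
    (hG.map_prodMk_eq_compProd hX T) hh h01 (fun t => (hξ.mem_Icc t t.2 τ).1)
    ((Finset.sum_coe_sort T fun t => ξ t τ).trans (hξ.sum_eq_one τ))
    (fun ω => ∫ x, h x ∂(G τ ω))
    hc fun ω => integral_mem_Icc hh h01

lemma IsDirectingProcess.measureReal_le_abs_sum_sub_le
    (hG : IsDirectingProcess d X P G) (hX : ∀ t, Measurable (X t)) (hξ : IsWeighting T ξ)
    (hh : Measurable h) (h01 : ∀ x, h x ∈ Set.Icc (0 : ℝ) 1) (τ : C)
    {ε : ℝ} (hε : 0 ≤ ε) :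
    P.real {ω | ε ≤ |∑ t : T, ξ t τ * h (X t ω) - ∑ t : T, ξ t τ * ∫ x, h x ∂(G t ω)|}
      ≤ 2 * Real.exp (-(2 * ε ^ 2) / ∑ t : T, ξ t τ ^ 2) := by
  have inst := fun t : T => hG.isMarkovKernel_generatedKernel t
  exact @LocalExch.measureReal_le_abs_sum_sub_le Ω Ω E T _ mΩ (sigmaOf G) _ P _ id
    (fun ω t => X t ω) (fun t => generatedKernel G t) inst h (fun t => ξ t τ)
    (measurable_id'' (sigmaOf_le G)) (measurable_pi_lambda _ fun t => hX t)
    (hG.map_prodMk_eq_compProd hX T) hh h01 (fun t => (hξ.mem_Icc t t.2 τ).1) ε hε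

lemma IsDirectingProcess.integral_abs_sum_sub_le
    (hG : IsDirectingProcess d X P G) (hξ : IsWeighting T ξ)
    (hh : Measurable h) (h01 : ∀ x, h x ∈ Set.Icc (0 : ℝ) 1) (τ : C) :
    ∫ ω, |∑ t : T, ξ t τ * ∫ x, h x ∂(G t ω) - ∫ x, h x ∂(G τ ω)| ∂P
      ≤ ∑ t ∈ T, ξ t τ * approxCoeff d h t τ := by
  have hi : ∀ t ∈ T, Integrable
      (fun ω => ξ t τ * |∫ x, h x ∂(G t ω) - ∫ x, h x ∂(G τ ω)|) P := fun t _ =>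
    ((integrable_integral_kernel hG hh h01 t).sub
      (integrable_integral_kernel hG hh h01 τ)).abs.const_mul _
  have hptw : ∀ ω, |∑ t : T, ξ t τ * ∫ x, h x ∂(G t ω) - ∫ x, h x ∂(G τ ω)|
      ≤ ∑ t ∈ T, ξ t τ * |∫ x, h x ∂(G t ω) - ∫ x, h x ∂(G τ ω)| := by
    intro ω
    -- Since the weights sum to one, `G τ h` can be moved inside the weighted sum.
    have : ∑ t : T, ξ t τ * ∫ x, h x ∂(G t ω) - ∫ x, h x ∂(G τ ω)
        = ∑ t ∈ T, ξ t τ * (∫ x, h x ∂(G t ω) - ∫ x, h x ∂(G τ ω)) := by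
      rw [Finset.sum_coe_sort T fun t => ξ t τ * ∫ x, h x ∂(G t ω)]
      simp_rw [mul_sub, Finset.sum_sub_distrib]
      rw [← Finset.sum_mul, hξ.sum_eq_one, one_mul]
    rw [this]
    refine (Finset.abs_sum_le_sum_abs _ _).trans (Finset.sum_le_sum fun t ht => ?_)
    rw [abs_mul, abs_of_nonneg (hξ.mem_Icc t ht τ).1]
  refine (integral_mono_of_nonneg (Eventually.of_forall fun ω => abs_nonneg _)
    (integrable_finsetSum _ hi) (Eventually.of_forall hptw)).trans ?_
  rw [integral_finsetSum _ hi]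
  simp_rw [integral_const_mul]
  exact Finset.sum_le_sum fun t ht => mul_le_mul_of_nonneg_left
    (hG.integral_abs_sub_le_approxCoeff hh h01 t τ) (hξ.mem_Icc t ht τ).1

end Estimation

end LocalExch

/-! ### The main theorem -/

theorem mainTheorem2 {Ω C E : Type*} [MeasurableSpace Ω] [MeasurableSpace E]
    [StandardBorelSpace E] (P : Measure Ω) [IsProbabilityMeasure P]
    (d : C → C → ℝ) (hd : LocalExch.IsPremetric d) (hsep : LocalExch.IsInfinitelySeparable d)
    (X : C → Ω → E) (hX : ∀ t, Measurable (X t))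
    (hexch : LocalExch.IsLocallyExchangeable d X P) :
    (∃ G : C → Kernel Ω E, LocalExch.IsDirectingProcess d X P G) ∧
    ∀ G : C → Kernel Ω E, LocalExch.IsDirectingProcess d X P G →
      ∀ (T : Finset C) (ξ : C → C → ℝ), LocalExch.IsWeighting T ξ →
      ∀ h : E → ℝ, Measurable h → (∀ x, h x ∈ Set.Icc (0 : ℝ) 1) →
      ∀ τ : C,
        Integrable (fun ω => ((∫ x, h x ∂(LocalExch.localEmpirical X T ξ τ ω))
            - ∫ x, h x ∂(G τ ω)) ^ 2) P ∧
        ∫ ω, ((∫ x, h x ∂(LocalExch.localEmpirical X T ξ τ ω)) - ∫ x, h x ∂(G τ ω)) ^ 2 ∂P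
          ≤ (1 / 4) * ∑ t ∈ T, ξ t τ ^ 2 + ∑ t ∈ T, ξ t τ * LocalExch.approxCoeff d h t τ ∧
        ∀ δ : ℝ, 0 < δ →
          P.real {ω | δ < |(∫ x, h x ∂(LocalExch.localEmpirical X T ξ τ ω))
              - ∫ x, h x ∂(G τ ω)|}
            ≤ ⨅ ε : Set.Ioo (0 : ℝ) δ,
                (2 * Real.exp (-(2 * (ε : ℝ) ^ 2) / ∑ t ∈ T, ξ t τ ^ 2)
                  + (δ - (ε : ℝ))⁻¹ * ∑ t ∈ T, ξ t τ * LocalExch.approxCoeff d h t τ) := by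
  refine ⟨hexch.exists_isDirectingProcess hd hsep hX, fun G hG T ξ hξ h hh h01 τ => ?_⟩
  have hmk := hG.isMarkov
  have hGm : ∀ t, Measurable fun ω => ∫ x, h x ∂(G t ω) := fun t =>
    hh.stronglyMeasurable.integral_kernel.measurable
  have hG01 : ∀ t ω, ∫ x, h x ∂(G t ω) ∈ Set.Icc (0 : ℝ) 1 := fun t ω =>
    LocalExch.integral_mem_Icc hh h01
  have hw : ∀ t : T, 0 ≤ ξ t τ := fun t => (hξ.mem_Icc t t.2 τ).1
  have hw1 : ∑ t : T, ξ t τ = 1 :=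
    (Finset.sum_coe_sort T fun t => ξ t τ).trans (hξ.sum_eq_one τ)
  have habs : ∀ {a b : ℝ}, a ∈ Set.Icc (0 : ℝ) 1 → b ∈ Set.Icc (0 : ℝ) 1 → |a - b| ≤ 1 :=
    fun ha hb => abs_le.2 ⟨by linarith [ha.1, hb.2], by linarith [ha.2, hb.1]⟩
  simp_rw [LocalExch.integral_localEmpirical hξ hh τ, ← Finset.sum_coe_sort T fun t => ξ t τ ^ 2]
  have hEm : Measurable fun ω => ∑ t : T, ξ t τ * h (X t ω) :=
    Finset.measurable_sum _ fun t _ => (hh.comp (hX t)).const_mul _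
  have hMm : Measurable fun ω => ∑ t : T, ξ t τ * ∫ x, h x ∂(G t ω) :=
    Finset.measurable_sum _ fun t _ => (hGm t).const_mul _
  have hbias := hG.integral_abs_sum_sub_le hξ hh h01 τ
  have hbd : ∀ ω, |∑ t : T, ξ t τ * ∫ x, h x ∂(G t ω) - ∫ x, h x ∂(G τ ω)| ≤ 1 := fun ω =>
    habs (LocalExch.sum_mul_mem_Icc hw hw1 fun t => hG01 t ω) (hG01 τ ω)
  have hbi : Integrable (fun ω => |∑ t : T, ξ t τ * ∫ x, h x ∂(G t ω) - ∫ x, h x ∂(G τ ω)|) P :=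
    Integrable.of_bound (hMm.sub (hGm τ)).abs.aestronglyMeasurable 1
      (Eventually.of_forall fun ω => by rw [Real.norm_eq_abs, abs_abs]; exact hbd ω)
  refine ⟨?_, ?_, fun δ hδ => ?_⟩
  · refine Integrable.of_bound ((hEm.sub (hGm τ)).pow_const 2).aestronglyMeasurable 1
      (Eventually.of_forall fun ω => ?_)
    rw [norm_pow, Real.norm_eq_abs]
    exact pow_le_one₀ (abs_nonneg _)
      (habs (LocalExch.sum_mul_mem_Icc hw hw1 fun t => h01 _) (hG01 τ ω))
  · refine (hG.integral_sum_sub_sq_le hX hξ hh h01 τ).trans (add_le_add le_rfl ?_)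
    refine (integral_mono_of_nonneg (Eventually.of_forall fun ω => sq_nonneg _) hbi
      (Eventually.of_forall fun ω => ?_)).trans hbias
    -- The bias is at most one in absolute value, so its square is bounded by its absolute value, to
    -- which the `L¹` estimate applies.
    dsimp only
    rw [← sq_abs]
    exact pow_le_of_le_one (abs_nonneg _) (hbd ω) two_ne_zero
  · have : Nonempty (Set.Ioo (0 : ℝ) δ) := ⟨⟨δ / 2, by linarith, by linarith⟩⟩
    refine le_ciInf fun ⟨ε, hε, hεδ⟩ => ?_
    have hpos : 0 < δ - ε := sub_pos.2 hεδ
    have h1 := hG.measureReal_le_abs_sum_sub_le hX hξ hh h01 τ hε.le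
    have h2 : P.real {ω | δ - ε ≤ |∑ t : T, ξ t τ * ∫ x, h x ∂(G t ω) - ∫ x, h x ∂(G τ ω)|}
        ≤ (δ - ε)⁻¹ * ∑ t ∈ T, ξ t τ * LocalExch.approxCoeff d h t τ := by
      rw [le_inv_mul_iff₀ hpos]
      exact (mul_meas_ge_le_integral_of_nonneg (Eventually.of_forall fun ω => abs_nonneg _)
        hbi _).trans hbias
    -- A deviation above `δ` forces a fluctuation of at least `ε` (Hoeffding) or a bias of at least
    -- `δ - ε` (Markov).
    refine (measureReal_mono ?_).trans ((measureReal_union_le _ _).trans (add_le_add h1 h2))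
    intro ω hω
    by_contra hcon
    simp only [Set.mem_union, Set.mem_ofPred_eq, not_or, not_le] at hcon hω
    have := abs_sub_le (∑ t : T, ξ t τ * h (X t ω)) (∑ t : T, ξ t τ * ∫ x, h x ∂(G t ω))
      (∫ x, h x ∂(G τ ω))
    linarith [hcon.1, hcon.2]
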